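/- **The model.** Let $k\ge 3$ be an integer and $d>0$, $\beta>0$ reals. For $n\ge k$ the random $k$-SAT formula $\boldsymbol\Phi$ on the variables $x_1,\dots,x_n$ has $\boldsymbol m\sim\mathrm{Po}(dn/k)$ clauses $a_1,\dots,a_{\boldsymbol m}$; given $\boldsymbol m$ the clauses are independent, and each consists of $k$ variables chosen uniformly without replacement, with independent uniform signs $\pm1$. An assignment $\sigma\in\{\pm1\}^{n}$ satisfies $a_i$ (written $\sigma\models a_i$) if some variable of $a_i$ has the value $\sigma_x$ equal to its sign. The Boltzmann distribution is $$\mu_{\boldsymbol\Phi,\beta}(\sigma)=\frac{1}{Z(\boldsymbol\Phi,\beta)}\exp\Big(-\beta\sum_{i=1}^{\boldsymbol m}\mathbf 1\{\sigma\not\models a_i\}\Big),\qquad Z(\boldsymbol\Phi,\beta)=\sum_{\tau\in\{\pm1\}^n}\exp\Big(-\beta\sum_{i=1}^{\boldsymbol m}\mathbf 1\{\tau\not\models a_i\}\Big).$$ The model with parameters $k,d,\beta$ is *replica symmetric* if $$\lim_{n\to\infty}\mathbb E\big|\mu_{\boldsymbol\Phi,\beta}(\{\sigma_{x_1}=\sigma_{x_2}=1\})-\mu_{\boldsymbol\Phi,\beta}(\{\sigma_{x_1}=1\})\,\mu_{\boldsymbol\Phi,\beta}(\{\sigma_{x_2}=1\})\big|=0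 .$$ Let $\pi_{\boldsymbol\Phi,\beta}=\frac1n\sum_{i=1}^n\delta_{\mu_{\boldsymbol\Phi,\beta}(\{\sigma_{x_i}=1\})}$ be the empirical distribution of the Boltzmann marginals, and let $d^*(k)=k2^k\ln 2-10k^2$. **Statement.** There is an absolute constant $k_0\ge 3$ such that for all integers $k\ge k_0$, all reals $\beta\ge1$ and all $0<d<d^*(k)$ the following holds. If the model with parameters $k,d,\beta$ is replica symmetric, then $\pi_{\boldsymbol\Phi,\beta}$ has very slim tails asymptotically almost surely, that is, $$\lim_{n\to\infty}\mathbb P\Big[\pi_{\boldsymbol\Phi,\beta}\big([0,\tfrac12-2^{-k/10}]\cup[\tfrac12+2^{-k/10},1]\big)\le 2^{-k/9}\Big]=1 .$$ -/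

import Mathlib

open MeasureTheory Filter Topology

noncomputable section

namespace RandomKSat

/-- A `k`-clause over the variables `x₁, …, xₙ` (indexed by `Fin n`): a family of `k` distinct
variables together with their signs `±1`. -/
structure Clause (k n : ℕ) where
  /-- the variables of the clause, pairwise distinct -/
  var : Fin k ↪ Fin n
  /-- the signs: `1` for a positive literal, `-1` for a negated one -/
  sign : Fin k → ℤˣ

/-- A `k`-SAT formula over `n` variables: a sequence `a₁, …, a_m` of clauses. -/
structure Formula (k n : ℕ) where
  /-- the number of clauses -/
  m : ℕ
  /-- the clauses -/
  clause : Fin m → Clause k n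

/-- Truth assignments; the truth values `true`, `false` are `1` and `-1`. -/
abbrev Assignment (n : ℕ) := Fin n → ℤˣ

variable {k n : ℕ}

/-- Some literal of the clause is true, i.e. the maximum over `j` of `sign j * σ (var j)` is `1`. -/
def Satisfies (σ : Assignment n) (a : Clause k n) : Prop :=
  ∃ j : Fin k, a.sign j * σ (a.var j) = 1

open Classical in
/-- The number of clauses of `Φ` that `σ` violates. -/
def violated (Φ : Formula k n) (σ : Assignment n) : ℕ :=
  ∑ i : Fin Φ.m, if Satisfies σ (Φ.clause i) then 0 else 1

/-- The partition function `Z(Φ, β)`. -/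
def partitionFunction (Φ : Formula k n) (β : ℝ) : ℝ :=
  ∑ τ : Assignment n, Real.exp (-β * violated Φ τ)

/-- The Boltzmann distribution `μ_{Φ,β}`, as a mass function. -/
def boltzmann (Φ : Formula k n) (β : ℝ) (σ : Assignment n) : ℝ :=
  Real.exp (-β * violated Φ σ) / partitionFunction Φ β

/-- The probability of an event under the Boltzmann distribution. -/
def boltzmannProb (Φ : Formula k n) (β : ℝ) (E : Set (Assignment n)) : ℝ :=
  ∑ σ : Assignment n, E.indicator (boltzmann Φ β) σ

/-- All sets of formulas are events; there are only countably many formulas. -/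
instance : MeasurableSpace (Formula k n) := ⊤

/-- The law of the random `k`-SAT formula on `n` variables with parameter `d`: the number of clauses
is Poisson with mean `d * n / k`, and, given that there are `m` clauses, the formula is uniform on
the finite set of all formulas with `m` clauses, i.e. the `m` clauses are independent, each of them
with `k` variables drawn uniformly without replacement and `k` independent uniform signs.
(For `k ≤ n` this is a probability measure; for `n < k` there is no clause to choose from.) -/
def randomFormula (k n : ℕ) (d : ℝ) : Measure (Formula k n) :=
  (ProbabilityTheory.poissonMeasure (d * n / k).toNNReal).bind
    fun m => ProbabilityTheory.uniformOn {Φ : Formula k n | Φ.m = m}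

/-- Replica symmetry of the random `k`-SAT model with parameters `d, β`. Two variables are needed
to state it, so the formula has `n + 2` variables, and `x₁`, `x₂` have the indices `0`, `1`. -/
def ReplicaSymmetric (k : ℕ) (d β : ℝ) : Prop :=
  Tendsto (fun n : ℕ => ∫ Φ : Formula k (n + 2),
      |boltzmannProb Φ β {σ | σ 0 = 1 ∧ σ 1 = 1}
        - boltzmannProb Φ β {σ | σ 0 = 1} * boltzmannProb Φ β {σ | σ 1 = 1}|
      ∂(randomFormula k (n + 2) d))
    atTop (𝓝 0)

/-- The empirical distribution `π_{Φ,β}` of the Boltzmann marginals. -/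
def empiricalMarginals (Φ : Formula k n) (β : ℝ) : Measure ℝ :=
  (n : ENNReal)⁻¹ • ∑ i : Fin n, Measure.dirac (boltzmannProb Φ β {σ | σ i = 1})

/-- A probability measure on `[0,1]` (seen as a measure on `ℝ`) has very slim tails. -/
def VerySlimTails (k : ℕ) (π : Measure ℝ) : Prop :=
  π (Set.Icc 0 (1 / 2 - (2 : ℝ) ^ (-(k : ℝ) / 10)) ∪
      Set.Icc (1 / 2 + (2 : ℝ) ^ (-(k : ℝ) / 10)) 1)
    ≤ ENNReal.ofReal ((2 : ℝ) ^ (-(k : ℝ) / 9))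

/-- The degree `d^*(k) = k 2^k ln 2 - 10 k²`. -/
def dStar (k : ℕ) : ℝ := k * 2 ^ k * Real.log 2 - 10 * k ^ 2

end RandomKSat

end

/-! If `p i` is the Boltzmann probability that variable `i` is true, then `∑ i, (2 * p i - 1) ^ 2`
is the mean of `n - 2 * hammingDist σ τ` over two independent samples (`sum_sq_marginals`). When the
tails are not very slim, this mean exceeds `2 * q * n` with `q = overlapBound k`, so the pairs of
overlap at least `q * n` carry Boltzmann mass at least `q`. To exclude this, fix the number `m ≤ M *
n` of clauses, `M = 2 ^ k * log 2 - 10 * k = dStar k / k`, and compare the unnormalised weight `W`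
of such pairs with `Z ^ 2`. The scale for both is `L = 2 ^ n * (1 - ε) ^ m`.

Upper bound on `W`: its expectation is at most `L ^ 2 * exp (-n / 2 ^ k)` up to a factor linear in
`n` (`expect_large_overlap_le`), because beyond overlap `q` the entropy lost by the pair exceeds the
gain from correlated clauses.

Lower bound on `Z`: its plain second moment is spoilt by the linear term of `(1 + α) ^ k` in the
overlap `α`. Multiplying each clause factor by `1 - ε * ∑ y`, where `y` are the literal values and
`ε * (1 - k * b) = b`, gives `weight ε ε`. Up to the effect of sampling without replacement, its
pair correlation is `(1 - ε) ^ 2 + ε ^ 2 * ((1 + α) ^ k - 1 - k * α)`, which has no linear term. The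
second moment method then works up to a factor linear in `n` (`expect_balancedSum_sq_le`).
Paley–Zygmund and Cauchy–Schwarz carry the bound over to `Z`, with probability of order `1 / n`
(`le_freq_partitionSum`). Since one clause moves `log Z` by at most `β`, concentration raises this
to `Z > L * exp (-η * n)` outside an exponentially small probability (`freq_log_partitionSum_le`).
Markov's inequality for `W` finishes the case of fixed `m`, and a Poisson tail bound disposes of `m
> M * n`. -/

noncomputable section

namespace RandomKSat

/-! ### Concentration and moment inequalities on finite uniform spaces. -/

section FiniteProbability

open Finset
open scoped BigOperators

/-- The average over a product with one more factor is an iterated average. -/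
theorem expect_fin_succ {C : Type*} [Fintype C] {m : ℕ} (f : (Fin (m + 1) → C) → ℝ) :
    𝔼 x, f x = 𝔼 x : Fin m → C, 𝔼 c, f (Fin.cons c x) := by
  rw [← Finset.expect_product' (s := univ) (t := univ) (f := fun x c => f (Fin.cons c x))]
  rw [Finset.univ_product_univ]
  refine (Fintype.expect_equiv ((Equiv.prodComm _ _).trans (Fin.consEquiv fun _ => C)) _ _ ?_).symm
  intro x
  rfl

/-- The product is the mean of `exp (f u - f v)` over two independent copies. Swapping the copies
replaces `exp` by `cosh`, and `cosh t ≤ exp (t ^ 2 / 2)`. No centring of `f` is needed. -/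
theorem expect_exp_mul_expect_exp_neg_le {C : Type*} [Fintype C] [Nonempty C] (f : C → ℝ) (b : ℝ)
    (hf : ∀ u v, |f u - f v| ≤ b) :
    (𝔼 u, Real.exp (f u)) * (𝔼 u, Real.exp (-f u)) ≤ Real.exp (b ^ 2 / 2) := by
  have h1 : (𝔼 u, Real.exp (f u)) * (𝔼 u, Real.exp (-f u))
      = 𝔼 u, 𝔼 v, Real.exp (f u - f v) := by
    rw [Finset.expect_mul_expect]
    simp_rw [← Real.exp_add, sub_eq_add_neg]
  have h2 : (𝔼 u, Real.exp (f u)) * (𝔼 u, Real.exp (-f u))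
      = 𝔼 u, 𝔼 v, Real.exp (-(f u - f v)) := by
    rw [h1, Finset.expect_comm]
    simp_rw [neg_sub]
  have h3 : (𝔼 u, Real.exp (f u)) * (𝔼 u, Real.exp (-f u))
      = 𝔼 u, 𝔼 v, Real.cosh (f u - f v) := by
    have : ∀ u v, Real.cosh (f u - f v)
        = Real.exp (f u - f v) / 2 + Real.exp (-(f u - f v)) / 2 := fun u v => by
      rw [Real.cosh_eq]; ring
    simp_rw [this, Finset.expect_add_distrib, ← Finset.expect_div]
    rw [← h1, ← h2]; ring
  rw [h3]
  refine Finset.expect_le univ_nonempty fun u _ =>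
    Finset.expect_le univ_nonempty fun v _ => ?_
  refine (Real.cosh_le_exp_half_sq _).trans (Real.exp_le_exp.2 ?_)
  have := sq_le_sq' (abs_le.1 (hf u v)).1 (abs_le.1 (hf u v)).2
  linarith

/-- Exponential concentration for functions with bounded differences on a finite product. -/
theorem expect_exp_mul_expect_exp_neg_le_of_bounded_differences {C : Type*} [Fintype C]
    [Nonempty C] (b : ℝ) : ∀ (m : ℕ) (f : (Fin m → C) → ℝ),
    (∀ x i c, |f (Function.update x i c) - f x| ≤ b) →
    (𝔼 x, Real.exp (f x)) * (𝔼 x, Real.exp (-f x)) ≤ Real.exp (m * (b ^ 2 / 2))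
  | 0, f, _ => by
    simp [← Real.exp_add]
  | m + 1, f, hf => by
    -- Integrating out the first coordinate inside the exponential keeps the mean of `exp f` exact
    -- and preserves bounded differences. The mean of `exp (-f)` then costs one factor `exp (b ^ 2 /
    -- 2)` from the one-coordinate case.
    set g : (Fin m → C) → ℝ := fun x => Real.log (𝔼 c, Real.exp (f (Fin.cons c x))) with hg
    have hpos : ∀ x : Fin m → C, 0 < 𝔼 c, Real.exp (f (Fin.cons c x)) := fun x =>
      Finset.expect_pos (fun _ _ => Real.exp_pos _) univ_nonempty
    have hexpg : ∀ x, Real.exp (g x) = 𝔼 c, Real.exp (f (Fin.cons c x)) := fun x =>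
      Real.exp_log (hpos x)
    have hshift : ∀ x i c d, f (Fin.cons d (Function.update x i c)) ≤ b + f (Fin.cons d x) := by
      intro x i c d
      have := (abs_le.1 (hf (Fin.cons d x) i.succ c)).2
      rw [← Fin.cons_update] at this
      linarith
    have hshift' : ∀ x i c d, f (Fin.cons d x) ≤ b + f (Fin.cons d (Function.update x i c)) := by
      intro x i c d
      have := (abs_le.1 (hf (Fin.cons d x) i.succ c)).1
      rw [← Fin.cons_update] at this
      linarith
    have hle : ∀ x y, (∀ d, f (Fin.cons d x) ≤ b + f (Fin.cons d y)) → g x ≤ b + g y := by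
      intro x y h
      rw [← Real.exp_le_exp, Real.exp_add, hexpg, hexpg, Finset.mul_expect]
      refine Finset.expect_le_expect fun d _ => ?_
      rw [← Real.exp_add]
      exact Real.exp_le_exp.2 (h d)
    have hgb : ∀ x i c, |g (Function.update x i c) - g x| ≤ b := by
      intro x i c
      rw [abs_le]
      have h1 := hle _ _ (hshift x i c)
      have h2 := hle _ _ (hshift' x i c)
      constructor <;> linarith
    have ih := expect_exp_mul_expect_exp_neg_le_of_bounded_differences b m g hgb
    have hlast : ∀ x : Fin m → C, ∀ u v, |f (Fin.cons u x) - f (Fin.cons v x)| ≤ b := by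
      intro x u v
      have := hf (Fin.cons v x) 0 u
      rwa [Fin.update_cons_zero] at this
    have hneg : ∀ x : Fin m → C, (𝔼 c, Real.exp (-f (Fin.cons c x)))
        ≤ Real.exp (b ^ 2 / 2) * Real.exp (-g x) := by
      intro x
      have h := expect_exp_mul_expect_exp_neg_le (fun c => f (Fin.cons c x)) b (hlast x)
      rw [← hexpg x] at h
      rw [Real.exp_neg, ← div_eq_mul_inv, le_div_iff₀ (Real.exp_pos _), mul_comm]
      exact h
    rw [expect_fin_succ, expect_fin_succ]
    simp_rw [← hexpg]
    calc _ ≤ (𝔼 x, Real.exp (g x)) * 𝔼 x, Real.exp (b ^ 2 / 2) * Real.exp (-g x) := by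
          refine mul_le_mul_of_nonneg_left (Finset.expect_le_expect fun x _ => hneg x) ?_
          exact Finset.expect_nonneg fun _ _ => (Real.exp_pos _).le
      _ = Real.exp (b ^ 2 / 2) * ((𝔼 x, Real.exp (g x)) * 𝔼 x, Real.exp (-g x)) := by
          rw [← Finset.mul_expect]; ring
      _ ≤ Real.exp (b ^ 2 / 2) * Real.exp (m * (b ^ 2 / 2)) := by gcongr
      _ = _ := by rw [← Real.exp_add]; push_cast; ring_nf

open Classical in
/-- The fraction of the elements of a finite type that satisfy a property. -/
def freq {Ω : Type*} [Fintype Ω] (A : Ω → Prop) : ℝ := 𝔼 x, if A x then (1 : ℝ) else 0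

theorem freq_nonneg {Ω : Type*} [Fintype Ω] (A : Ω → Prop) : 0 ≤ freq A :=
  Finset.expect_nonneg fun _ _ => by split_ifs <;> norm_num

theorem freq_mono {Ω : Type*} [Fintype Ω] {A B : Ω → Prop} (h : ∀ x, A x → B x) :
    freq A ≤ freq B := by
  refine Finset.expect_le_expect fun x _ => ?_
  by_cases hA : A x
  · simp [hA, h x hA]
  · simp only [hA, if_false]; split_ifs <;> norm_num

theorem freq_or_le {Ω : Type*} [Fintype Ω] (A B : Ω → Prop) :
    freq (fun x => A x ∨ B x) ≤ freq A + freq B := by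
  unfold freq
  rw [← Finset.expect_add_distrib]
  refine Finset.expect_le_expect fun x _ => ?_
  by_cases hA : A x <;> by_cases hB : B x <;> simp [hA, hB]

theorem mul_freq_le_expect {Ω : Type*} [Fintype Ω] (A : Ω → Prop) (f : Ω → ℝ) (t : ℝ)
    (hf : ∀ x, 0 ≤ f x) (h : ∀ x, A x → t ≤ f x) : t * freq A ≤ 𝔼 x, f x := by
  unfold freq
  rw [Finset.mul_expect]
  refine Finset.expect_le_expect fun x _ => ?_
  by_cases hA : A x
  · simpa [hA] using h x hA
  · simpa [hA] using hf x

/-- A function with bounded differences cannot have two far apart values that are both likely. -/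
theorem freq_ge_mul_freq_le_of_bounded_differences {C : Type*} [Fintype C] [Nonempty C] (b : ℝ)
    (m : ℕ) (f : (Fin m → C) → ℝ) (hf : ∀ x i c, |f (Function.update x i c) - f x| ≤ b)
    (a s l : ℝ) (hl : 0 ≤ l) :
    freq (fun x => a ≤ f x) * freq (fun x => f x ≤ a - s)
      ≤ Real.exp (m * (l ^ 2 * b ^ 2 / 2) - l * s) := by
  have h := expect_exp_mul_expect_exp_neg_le_of_bounded_differences (l * b) m (fun x => l * f x)
    (fun x i c => by
      rw [← mul_sub, abs_mul, abs_of_nonneg hl]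
      exact mul_le_mul_of_nonneg_left (hf x i c) hl)
  have h1 := mul_freq_le_expect (fun x => a ≤ f x) (fun x => Real.exp (l * f x)) (Real.exp (l * a))
    (fun x => (Real.exp_pos _).le)
    (fun x hx => Real.exp_le_exp.2 (mul_le_mul_of_nonneg_left hx hl))
  have h2 := mul_freq_le_expect (fun x => f x ≤ a - s) (fun x => Real.exp (-(l * f x)))
    (Real.exp (-(l * (a - s)))) (fun x => (Real.exp_pos _).le)
    (fun x hx => Real.exp_le_exp.2 (neg_le_neg (mul_le_mul_of_nonneg_left hx hl)))
  have h3 : Real.exp (l * s) * (freq (fun x => a ≤ f x) * freq (fun x => f x ≤ a - s))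
      ≤ Real.exp (m * ((l * b) ^ 2 / 2)) := by
    refine le_trans (le_of_eq ?_) ((mul_le_mul h1 h2
      (mul_nonneg (Real.exp_pos _).le (freq_nonneg _))
      (Finset.expect_nonneg fun _ _ => (Real.exp_pos _).le)).trans h)
    have : Real.exp (l * s) = Real.exp (l * a) * Real.exp (-(l * (a - s))) := by
      rw [← Real.exp_add]; ring_nf
    rw [this]; ring
  rw [Real.exp_sub, le_div_iff₀ (Real.exp_pos _), mul_comm]
  rwa [← mul_pow]

/-- The Paley–Zygmund inequality on a finite probability space. -/
theorem sq_expect_le_freq_mul_expect_sq {Ω : Type*} [Fintype Ω] [Nonempty Ω] (f : Ω → ℝ)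
    (h0 : 0 ≤ 𝔼 x, f x) :
    (𝔼 x, f x) ^ 2 ≤ 4 * (freq fun x => (𝔼 x, f x) / 2 ≤ f x) * 𝔼 x, f x ^ 2 := by
  classical
  set E := 𝔼 x, f x with hE
  set χ : Ω → ℝ := fun x => if E / 2 ≤ f x then 1 else 0 with hχ
  have h1 : E / 2 ≤ 𝔼 x, f x * χ x := by
    have : E ≤ 𝔼 x, (E / 2 + f x * χ x) := by
      conv_lhs => rw [hE]
      refine Finset.expect_le_expect fun x _ => ?_
      by_cases hx : E / 2 ≤ f x
      · simp only [hχ, hx, if_true]; linarith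
      · simp [hχ, hx]; linarith
    rw [Finset.expect_add_distrib, Fintype.expect_const] at this
    linarith
  have h2 : (𝔼 x, f x * χ x) ^ 2 ≤ (𝔼 x, f x ^ 2) * 𝔼 x, χ x ^ 2 := by
    simp_rw [Fintype.expect_eq_sum_div_card]
    rw [div_pow, div_mul_div_comm, ← sq]
    gcongr
    exact Finset.sum_mul_sq_le_sq_mul_sq _ _ _
  have h3 : (𝔼 x, χ x ^ 2) = freq fun x => E / 2 ≤ f x := by
    unfold freq
    refine Finset.expect_congr rfl fun x _ => ?_
    simp only [hχ]
    split_ifs <;> norm_num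
  rw [h3] at h2
  have h4 : (E / 2) ^ 2 ≤ (𝔼 x, f x * χ x) ^ 2 := by gcongr
  linarith

end FiniteProbability

/-! ### Bounds on the binary entropy. -/

section Entropy

/-- One term of Gibbs' inequality, with `p` a free comparison weight: summed over a probability
vector, the corrections `p - x` cancel. -/
theorem mul_log_inv_le {x p : ℝ} (hx : 0 ≤ x) (hp : 0 < p) :
    x * Real.log x⁻¹ ≤ x * Real.log p⁻¹ + (p - x) := by
  rcases hx.eq_or_lt with rfl | hx
  · simpa using hp.le
  · have h := Real.log_le_sub_one_of_pos (div_pos hp hx)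
    rw [Real.log_div hp.ne' hx.ne'] at h
    have h2 := mul_le_mul_of_nonneg_left h hx.le
    have h3 : x * (p / x - 1) = p - x := by field_simp
    rw [Real.log_inv, Real.log_inv]
    linarith

theorem binEntropy_le_add {x : ℝ} (h1 : x ≤ 1) :
    Real.binEntropy x ≤ x * Real.log x⁻¹ + x := by
  have := mul_log_inv_le (sub_nonneg.2 h1) one_pos
  rw [Real.binEntropy]
  simp only [inv_one, Real.log_one, mul_zero] at this
  linarith

theorem binEntropy_le_sub_sq {x : ℝ} (h0 : 0 ≤ x) (h1 : x ≤ 1) :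
    Real.binEntropy x ≤ Real.log 2 - (1 - 2 * x) ^ 2 / 2 := by
  -- The comparison law is proportional to `exp (∓l)`. Gibbs' inequality gives `log 2 + log (cosh l)
  -- - l ^ 2`, and `log (cosh l) ≤ l ^ 2 / 2`.
  set l := 1 - 2 * x with hl
  have hc := Real.cosh_pos l
  have hlog : Real.log (Real.cosh l) ≤ l ^ 2 / 2 :=
    (Real.log_le_iff_le_exp hc).2 (Real.cosh_le_exp_half_sq l)
  have e1 := mul_log_inv_le h0 (div_pos (Real.exp_pos (-l)) (mul_pos two_pos hc))
  have e2 := mul_log_inv_le (sub_nonneg.2 h1) (div_pos (Real.exp_pos l) (mul_pos two_pos hc))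
  rw [inv_div, Real.log_div (by positivity) (Real.exp_ne_zero _), Real.log_mul two_ne_zero hc.ne',
    Real.log_exp] at e1 e2
  have e3 : Real.exp (-l) / (2 * Real.cosh l) + Real.exp l / (2 * Real.cosh l) = 1 := by
    rw [← add_div, div_eq_one_iff_eq (by positivity), Real.cosh_eq]; ring
  rw [Real.binEntropy]
  nlinarith

theorem mul_add_log_inv_le_exp {x A : ℝ} (hx : 0 ≤ x) :
    x * (A + Real.log x⁻¹) ≤ Real.exp (A - 1) := by
  have := mul_log_inv_le hx (Real.exp_pos (A - 1))
  rw [Real.log_inv (Real.exp _), Real.log_exp] at this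
  linarith

end Entropy

/-! ### Entropy against clause correlation at clause density `M`. -/

section Exponents

/-- The conditions that make the clause length `k` large enough for the second moment estimates. -/
structure LargeLength (k : ℕ) (q : ℝ) : Prop where
  two_hundred_le : 200 ≤ k
  log_le : 2 + 2 * Real.log k ≤ Real.log 2 * k / 21
  cube_le : (2 * k + 1) * (k : ℝ) ^ 2 ≤ 2 ^ k
  q_pos : 0 < q
  q_le : q ≤ 1 / k
  le_q_sq : (2 * k + 4) / (2 : ℝ) ^ k ≤ q ^ 2 / 2
  pow_le : (3 / 4 : ℝ) ^ k + (2 * k + 1) / 2 ^ k ≤ 1 / (2 * (k : ℝ) ^ 2)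

variable {k : ℕ} {q : ℝ}

theorem one_sub_pow_le_exp {x : ℝ} (hx : x ≤ 1) : (1 - x) ^ k ≤ Real.exp (-(k * x)) := by
  have h : 1 - x ≤ Real.exp (-x) := Real.one_sub_le_exp_neg x
  calc (1 - x) ^ k ≤ Real.exp (-x) ^ k := pow_le_pow_left₀ (by linarith) h k
    _ = _ := by rw [← Real.exp_nat_mul]; ring_nf

theorem one_sub_pow_le_inv {x : ℝ} (h0 : 0 ≤ x) (hx : x ≤ 1) : (1 - x) ^ k ≤ (1 + k * x)⁻¹ := by
  refine (one_sub_pow_le_exp hx).trans ?_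
  rw [Real.exp_neg]
  have := Real.add_one_le_exp (k * x)
  have : 0 ≤ k * x := by positivity
  gcongr
  linarith

theorem two_mul_add_one_div_two_pow_le (hk : LargeLength k q) :
    (2 * k + 1) / (2 : ℝ) ^ k ≤ 1 / (k : ℝ) ^ 2 := by
  have hkR : (200 : ℝ) ≤ k := by exact_mod_cast hk.two_hundred_le
  have hkpos : (0 : ℝ) < k := by linarith
  rw [div_le_div_iff₀ (by positivity) (by positivity)]
  linarith [hk.cube_le]

/-- Away from `x = 0` the gain `6 * k / 2 ^ k` from the density deficit is not needed, so it is
dropped here. -/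
theorem log_two_mul_add_le_coarse {x : ℝ} (hx1 : x ≤ 1) :
    Real.log 2 * ((1 - 6 * k / 2 ^ k) * (1 - x) ^ k + 2 * k / 2 ^ k) + 1 / 2 ^ k
      ≤ Real.log 2 * (1 - x) ^ k + (2 * k + 1) / 2 ^ k := by
  have hlog := Real.log_two_gt_d9
  have hlog' := Real.log_two_lt_d9
  have hA0 : 0 ≤ (1 - x) ^ k := pow_nonneg (by linarith) _
  have e1 : (1 - 6 * k / 2 ^ k) * (1 - x) ^ k ≤ (1 - x) ^ k := by
    have : 0 ≤ 6 * k / 2 ^ k * (1 - x) ^ k := by positivity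
    linarith
  have e2 : Real.log 2 * (2 * k / 2 ^ k) ≤ 2 * k / 2 ^ k :=
    mul_le_of_le_one_left (by positivity) (by linarith)
  have e3 : Real.log 2 * ((1 - 6 * k / 2 ^ k) * (1 - x) ^ k) ≤ Real.log 2 * (1 - x) ^ k :=
    mul_le_mul_of_nonneg_left e1 (by linarith)
  rw [add_div]
  linarith

/-- This is the only range where the density deficit decides. Expanding `(1 - x) ^ k` to first order
leaves `x * (1 + log 2 - k * log 2 + log x⁻¹)`, whose maximum is `2 / 2 ^ k`. The deficit, at least
of order `k / 2 ^ k`, absorbs it. -/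
theorem log_two_mul_add_binEntropy_le_of_le_inv_sq (hk : LargeLength k q) {x : ℝ} (h0 : 0 ≤ x)
    (hx : x ≤ 1 / (k : ℝ) ^ 2) :
    Real.log 2 * ((1 - 6 * k / 2 ^ k) * (1 - x) ^ k + 2 * k / 2 ^ k) + 1 / 2 ^ k
      + Real.binEntropy x ≤ Real.log 2 := by
  have hkR : (200 : ℝ) ≤ k := by exact_mod_cast hk.two_hundred_le
  have hkpos : (0 : ℝ) < k := by linarith
  have hlog := Real.log_two_gt_d9
  have hlog' := Real.log_two_lt_d9
  have hkx : k ^ 2 * x ≤ 1 := by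
    rw [le_div_iff₀ (by positivity)] at hx; linarith
  have hkx2 : (k : ℝ) * x ≤ 1 / 4 := by nlinarith
  have hkx0 : 0 ≤ (k : ℝ) * x := by positivity
  have hx1 : x ≤ 1 := by nlinarith
  have hH := binEntropy_le_add hx1
  have hup : (1 - x) ^ k ≤ 1 - k * x + x := by
    have e := (abs_le.1 (Real.abs_exp_sub_one_sub_id_le (x := -(k * x))
      (by rw [abs_neg, abs_of_nonneg hkx0]; linarith))).2
    have e2 := one_sub_pow_le_exp (k := k) hx1
    have e3 : (-(k * x)) ^ 2 ≤ x := by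
      have := mul_le_mul_of_nonneg_right hkx h0
      calc (-(k * x)) ^ 2 = k ^ 2 * x * x := by ring
        _ ≤ x := by linarith
    linarith
  have hlow : 3 / 4 ≤ (1 - x) ^ k := by
    have := one_add_mul_le_pow (a := -x) (by linarith) k
    have e : (1 + -x) = 1 - x := by ring
    rw [e] at this
    linarith
  have hmax := mul_add_log_inv_le_exp (A := 1 + Real.log 2 - k * Real.log 2) h0
  have hexp : Real.exp (1 + Real.log 2 - k * Real.log 2 - 1) = 2 / 2 ^ k := by
    have : 1 + Real.log 2 - k * Real.log 2 - 1 = Real.log 2 - k * Real.log 2 := by ring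
    rw [this, Real.exp_sub, Real.exp_log two_pos, Real.exp_nat_mul, Real.exp_log two_pos]
  rw [hexp] at hmax
  generalize (1 - x) ^ k = P at *
  set t : ℝ := 1 / 2 ^ k with ht
  have ht0 : 0 < t := by positivity
  have t1 : 6 * (k : ℝ) / 2 ^ k = 6 * k * t := by rw [ht]; ring
  have t2 : 2 * (k : ℝ) / 2 ^ k = 2 * k * t := by rw [ht]; ring
  have t3 : 2 / (2 : ℝ) ^ k = 2 * t := by rw [ht]; ring
  rw [t1, t2]
  rw [t3] at hmax
  have hkt : 0 ≤ k * t := by positivity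
  have hfirst : (1 - 6 * k * t) * P + 2 * k * t ≤ 1 - k * x + x - 2.5 * (k * t) := by
    have := mul_le_mul_of_nonneg_left hlow hkt
    linarith
  have hfirst2 := mul_le_mul_of_nonneg_left hfirst (by linarith : 0 ≤ Real.log 2)
  have h5 : 1 * (k * t) ≤ Real.log 2 * 2.5 * (k * t) :=
    mul_le_mul_of_nonneg_right (by linarith) hkt
  have h6 : 200 * t ≤ k * t := by gcongr
  linarith

/-- Up to `20 / k`, the loss `k * x / 21` in `(1 - x) ^ k` beats the entropy, as `log x⁻¹ ≤ 2 * log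
k`. Beyond that, `(1 - x) ^ k ≤ 1 / 21` is below the entropy deficit, at least `1 / 8` for `x ≤ 1 /
4`. -/
theorem log_two_mul_add_binEntropy_le_of_inv_sq_le (hk : LargeLength k q) {x : ℝ} (h0 : 0 ≤ x)
    (hx : 1 / (k : ℝ) ^ 2 ≤ x) (hx' : x ≤ 1 / 4) :
    Real.log 2 * (1 - x) ^ k + (2 * k + 1) / 2 ^ k + Real.binEntropy x ≤ Real.log 2 := by
  have hkR : (200 : ℝ) ≤ k := by exact_mod_cast hk.two_hundred_le
  have hkpos : (0 : ℝ) < k := by linarith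
  have hlog := Real.log_two_gt_d9
  have hlog' := Real.log_two_lt_d9
  have hx1 : x ≤ 1 := by linarith
  have hcube := two_mul_add_one_div_two_pow_le hk
  have hx0 : 0 < x := lt_of_lt_of_le (by positivity) hx
  have hinv := one_sub_pow_le_inv (k := k) h0 hx1
  rcases le_total x (20 / k) with hx2 | hx2
  · have hNx : (2 * k + 1) / (2 : ℝ) ^ k ≤ x := hcube.trans hx
    have hH := binEntropy_le_add hx1
    have hkx : k * x ≤ 20 := by rw [le_div_iff₀ hkpos] at hx2; linarith
    have hA : (1 - x) ^ k ≤ 1 - k * x / 21 := by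
      refine hinv.trans ?_
      have : 0 ≤ k * x := by positivity
      rw [inv_le_iff_one_le_mul₀ (by linarith)]
      nlinarith
    have hlx : Real.log x⁻¹ ≤ 2 * Real.log k := by
      have : x⁻¹ ≤ (k : ℝ) ^ 2 := by
        rw [inv_le_comm₀ hx0 (by positivity)]; simpa using hx
      calc Real.log x⁻¹ ≤ Real.log ((k : ℝ) ^ 2) := Real.log_le_log (by positivity) this
        _ = _ := by rw [Real.log_pow]; norm_num
    have e1 := mul_le_mul_of_nonneg_left hlx h0
    have e2 := mul_le_mul_of_nonneg_left hA (by linarith : 0 ≤ Real.log 2)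
    have e3 := mul_le_mul_of_nonneg_left hk.log_le h0
    generalize (1 - x) ^ k = P at *
    linarith
  · have hH2 := binEntropy_le_sub_sq h0 hx1
    have hkx : 20 ≤ k * x := by rw [div_le_iff₀ hkpos] at hx2; linarith
    have hA : (1 - x) ^ k ≤ 1 / 21 := by
      refine hinv.trans ?_
      rw [one_div]
      gcongr
      linarith
    have h3 : 1 / (k : ℝ) ^ 2 ≤ 1 / 200 := by
      rw [div_le_div_iff₀ (by positivity) (by norm_num)]; nlinarith
    have h4 : 1 / 4 ≤ (1 - 2 * x) ^ 2 := by nlinarith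
    have h5 := mul_le_mul_of_nonneg_left hA (by linarith : 0 ≤ Real.log 2)
    generalize (1 - x) ^ k = P at *
    linarith

/-- The entropy deficit is at least `α ^ 2 / 2` with `α = 1 - 2 * x`. If `α ≤ 1 / k` then `(1 - x) ^
k ≤ 3 / 2 ^ k`, and `α ≥ q` suffices; otherwise `(3 / 4) ^ k` is compared with `1 / (2 * k ^ 2)`. -/
theorem log_two_mul_add_binEntropy_le_of_quarter_le (hk : LargeLength k q) {x : ℝ}
    (hx3 : 1 / 4 ≤ x) (h1 : x ≤ (1 - q) / 2) :
    Real.log 2 * (1 - x) ^ k + (2 * k + 1) / 2 ^ k + Real.binEntropy x ≤ Real.log 2 := by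
  have hkR : (200 : ℝ) ≤ k := by exact_mod_cast hk.two_hundred_le
  have hkpos : (0 : ℝ) < k := by linarith
  have hq := hk.q_pos
  have hlog := Real.log_two_gt_d9
  have hlog' := Real.log_two_lt_d9
  have hx1 : x ≤ 1 := by linarith
  have hA0 : 0 ≤ (1 - x) ^ k := pow_nonneg (by linarith) _
  have hH2 := binEntropy_le_sub_sq (by linarith) hx1
  have hqx : q ≤ 1 - 2 * x := by linarith
  have hA' : Real.log 2 * (1 - x) ^ k ≤ (1 - x) ^ k :=
    mul_le_of_le_one_left hA0 (by linarith)
  rcases le_total (1 - 2 * x) (1 / k) with hx4 | hx4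
  · have hA : (1 - x) ^ k ≤ 3 / 2 ^ k := by
      have e1 : (1 - x) ^ k = (1 - -(1 - 2 * x)) ^ k / 2 ^ k := by
        rw [← div_pow]; congr 1; ring
      have e2 := one_sub_pow_le_exp (k := k) (x := -(1 - 2 * x)) (by linarith)
      have e3 : Real.exp (-(k * -(1 - 2 * x))) ≤ 3 := by
        have : -(k * -(1 - 2 * x)) ≤ 1 := by
          rw [le_div_iff₀ hkpos] at hx4; linarith
        have := Real.exp_le_exp.2 this
        have := Real.exp_one_lt_d9
        linarith
      rw [e1]
      gcongr
      exact e2.trans e3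
    have e5 := hk.le_q_sq
    have e6 : q ^ 2 ≤ (1 - 2 * x) ^ 2 := by gcongr
    have e7 : (2 * k + 4) / (2 : ℝ) ^ k = 3 / 2 ^ k + (2 * k + 1) / 2 ^ k := by ring
    linarith
  · have hA : (1 - x) ^ k ≤ (3 / 4) ^ k := pow_le_pow_left₀ (by linarith) (by linarith) k
    have e5 := hk.pow_le
    have e6 : 1 / (k : ℝ) ^ 2 ≤ (1 - 2 * x) ^ 2 := by
      have : (1 / (k : ℝ)) ^ 2 ≤ (1 - 2 * x) ^ 2 := by gcongr
      simpa [div_pow] using this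
    have e7 : 1 / (2 * (k : ℝ) ^ 2) = 1 / (k : ℝ) ^ 2 / 2 := by ring
    linarith

theorem log_two_mul_add_binEntropy_le (hk : LargeLength k q) {x : ℝ} (h0 : 0 ≤ x)
    (h1 : x ≤ (1 - q) / 2) :
    Real.log 2 * ((1 - 6 * k / 2 ^ k) * (1 - x) ^ k + 2 * k / 2 ^ k) + 1 / 2 ^ k
      + Real.binEntropy x ≤ Real.log 2 := by
  have hcoarse := log_two_mul_add_le_coarse (k := k) (x := x) (by linarith [hk.q_pos])
  rcases le_total x (1 / (k : ℝ) ^ 2) with hx | hx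
  · exact log_two_mul_add_binEntropy_le_of_le_inv_sq hk h0 hx
  rcases le_total x (1 / 4) with hx3 | hx3
  · linarith [log_two_mul_add_binEntropy_le_of_inv_sq_le hk h0 hx hx3]
  · linarith [log_two_mul_add_binEntropy_le_of_quarter_le hk hx3 h1]

/-- Bernoulli's inequality for `α = 1 - 2 x` is sharp up to second order as long as `α ≤ 1 / k`. -/
theorem pow_sub_one_sub_le (hk : LargeLength k q) {x : ℝ} (h1 : x ≤ 1)
    (hx : (1 - 2 * x) ≤ 1 / k) :
    2 ^ k * (1 - x) ^ k - 1 - k * (1 - 2 * x) ≤ k ^ 2 * (1 - 2 * x) ^ 2 := by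
  have hkR : (200 : ℝ) ≤ k := by exact_mod_cast hk.two_hundred_le
  have hkpos : (0 : ℝ) < k := by linarith
  have e1 : 2 ^ k * (1 - x) ^ k = (1 - -(1 - 2 * x)) ^ k := by
    rw [← mul_pow]; congr 1; ring
  rw [e1]
  rw [le_div_iff₀ hkpos] at hx
  rcases le_total (-1) ((1 - 2 * x) * k) with h | h
  · have e2 := one_sub_pow_le_exp (k := k) (x := -(1 - 2 * x)) (by linarith)
    have e3 := (abs_le.1 (Real.abs_exp_sub_one_sub_id_le (x := -(k * -(1 - 2 * x)))
      (abs_le.2 ⟨by linarith, by linarith⟩))).2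
    nlinarith
  · have e2 : (1 - -(1 - 2 * x)) ^ k ≤ 1 := pow_le_one₀ (by linarith) (by nlinarith)
    nlinarith

/-- After clearing denominators, the terms of order `k * N`, `N = 2 ^ k`, decide: `6 * k` from the
target and `2 * (k + 1)` from the square sum to `8 * k + 2`, and `log 2 * (8 * k + 2) ≤ 10 * k`. -/
theorem density_mul_le (hk : LargeLength k q) {κ : ℝ}
    (hκ : κ ≤ (1 / (2 ^ k - k - 1 : ℝ)) ^ 2) :
    (2 ^ k * Real.log 2 - 10 * k) * κ ≤ Real.log 2 / 2 ^ k * (1 - 6 * k / 2 ^ k) := by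
  have hkR : (200 : ℝ) ≤ k := by exact_mod_cast hk.two_hundred_le
  have hcube := hk.cube_le
  have hlog := Real.log_two_gt_d9
  have hlog' := Real.log_two_lt_d9
  set N : ℝ := 2 ^ k with hN
  have hN1 : 100 * (k : ℝ) ≤ N := by nlinarith
  have hM : 0 ≤ N * Real.log 2 - 10 * k := by nlinarith
  refine (mul_le_mul_of_nonneg_left hκ hM).trans ?_
  have hN0 : 0 < N := by linarith
  have hd : 0 < N - k - 1 := by linarith
  have e : Real.log 2 / N * (1 - 6 * k / N) = Real.log 2 * (N - 6 * k) / N ^ 2 := by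
    field_simp
  rw [e, div_pow, one_pow, mul_one_div, div_le_div_iff₀ (by positivity) (by positivity)]
  have e2 : Real.log 2 * (N - 6 * k) * (N ^ 2 - 2 * (k + 1) * N)
      ≤ Real.log 2 * (N - 6 * k) * (N - k - 1) ^ 2 := by
    refine mul_le_mul_of_nonneg_left ?_ (mul_nonneg (by linarith) (by linarith))
    nlinarith
  refine le_trans ?_ e2
  have e3 : (N * Real.log 2 - 10 * k) * N ≤ Real.log 2 * ((N - 6 * k) * (N - 2 * (k + 1))) := by
    have : N ^ 2 - (8 * k + 2) * N ≤ (N - 6 * k) * (N - 2 * (k + 1)) := by nlinarith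
    have := mul_le_mul_of_nonneg_left this (by linarith : 0 ≤ Real.log 2)
    have : Real.log 2 * ((8 * k + 2) * N) ≤ 10 * k * N := by
      have : Real.log 2 * (8 * k + 2) ≤ 10 * k := by nlinarith
      nlinarith
    nlinarith
  nlinarith

/-- The exponent for the unbalanced weights. The summand `2 * k` pays for replacing `1 - 2 * b` by
`(1 - ε) ^ 2`, and `1 / 2 ^ k` is the exponential gain kept for Markov's inequality. -/
theorem density_mul_overlap_le (hk : LargeLength k q) {κ : ℝ}
    (hκ : κ ≤ (1 / (2 ^ k - k - 1 : ℝ)) ^ 2) {x : ℝ} (h0 : 0 ≤ x) (h1 : x ≤ (1 - q) / 2) :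
    (2 ^ k * Real.log 2 - 10 * k) * κ * (2 ^ k * (1 - x) ^ k + 2 * k)
      ≤ Real.log 2 - Real.binEntropy x - 1 / 2 ^ k := by
  have hq := hk.q_pos
  have hA0 : 0 ≤ (1 - x) ^ k := pow_nonneg (by linarith) _
  have h := mul_le_mul_of_nonneg_right (density_mul_le hk hκ)
    (by positivity : 0 ≤ 2 ^ k * (1 - x) ^ k + 2 * k)
  refine h.trans ?_
  have hmain := log_two_mul_add_binEntropy_le hk h0 h1
  have hlog := Real.log_two_gt_d9
  have e : Real.log 2 / 2 ^ k * (1 - 6 * k / 2 ^ k) * (2 ^ k * (1 - x) ^ k + 2 * k)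
      ≤ Real.log 2 * ((1 - 6 * k / 2 ^ k) * (1 - x) ^ k + 2 * k / 2 ^ k) := by
    have e1 : Real.log 2 / 2 ^ k * (1 - 6 * k / 2 ^ k) * (2 ^ k * (1 - x) ^ k + 2 * k)
      = Real.log 2 * ((1 - 6 * k / 2 ^ k) * (1 - x) ^ k + (1 - 6 * k / 2 ^ k) * (2 * k / 2 ^ k)) := by
      field_simp
    rw [e1]
    have : (0 : ℝ) ≤ 6 * k / 2 ^ k * (2 * k / 2 ^ k) := by positivity
    refine mul_le_mul_of_nonneg_left ?_ (by linarith)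
    linarith
  linarith

/-- For overlap at least `q` the previous bound is stronger. For smaller or negative overlap both
sides are quadratic: the left is at most `k ^ 2 * α ^ 2 / 2 ^ k`, the right at least `α ^ 2 / 2`. -/
theorem density_mul_balanced_le (hk : LargeLength k q) {κ : ℝ} (hκ0 : 0 ≤ κ)
    (hκ : κ ≤ (1 / (2 ^ k - k - 1 : ℝ)) ^ 2) {x : ℝ} (h0 : 0 ≤ x) (h1 : x ≤ 1) :
    (2 ^ k * Real.log 2 - 10 * k) * κ * (2 ^ k * (1 - x) ^ k - 1 - k * (1 - 2 * x))
      ≤ Real.log 2 - Real.binEntropy x := by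
  have hkR : (200 : ℝ) ≤ k := by exact_mod_cast hk.two_hundred_le
  have hlog := Real.log_two_gt_d9
  have hlog' := Real.log_two_lt_d9
  have hcube := hk.cube_le
  have hN : (0 : ℝ) < 2 ^ k := by positivity
  have hM : (0 : ℝ) ≤ 2 ^ k * Real.log 2 - 10 * k := by nlinarith
  rcases le_total x ((1 - q) / 2) with hx | hx
  · refine le_trans ?_ ((density_mul_overlap_le hk hκ h0 hx).trans ?_)
    · refine mul_le_mul_of_nonneg_left ?_ (mul_nonneg hM hκ0)
      nlinarith
    · have : (0 : ℝ) < 1 / 2 ^ k := by positivity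
      linarith
  · have hbr := pow_sub_one_sub_le hk h1 (by linarith [hk.q_le])
    have hd := density_mul_le hk hκ
    have hMκ : 0 ≤ (2 ^ k * Real.log 2 - 10 * k) * κ := mul_nonneg hM hκ0
    have h2 := mul_le_mul_of_nonneg_left hbr hMκ
    have h3 : (2 ^ k * Real.log 2 - 10 * k) * κ ≤ 1 / 2 ^ k := by
      refine hd.trans ?_
      have e1 : Real.log 2 / 2 ^ k ≤ 1 / 2 ^ k := by gcongr; linarith
      have e2 : (0 : ℝ) ≤ 6 * k / 2 ^ k := by positivity
      have e3 : 0 ≤ Real.log 2 / 2 ^ k := by positivity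
      nlinarith
    have h4 : 1 / (2 : ℝ) ^ k * k ^ 2 ≤ 1 / 2 := by
      rw [one_div_mul_eq_div, div_le_iff₀ hN]; nlinarith
    have h5 : (2 ^ k * Real.log 2 - 10 * k) * κ * (k : ℝ) ^ 2 ≤ 1 / 2 :=
      (mul_le_mul_of_nonneg_right h3 (by positivity)).trans h4
    have h6 := mul_le_mul_of_nonneg_right h5 (sq_nonneg (1 - 2 * x))
    have hH2 := binEntropy_le_sub_sq h0 h1
    linarith

end Exponents

/-! ### Correlation of clause weights under two assignments. -/

section ClauseAverages

open Finset
open scoped BigOperators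

theorem expect_pi_prod {C : Type*} [Fintype C] [Nonempty C] {k : ℕ} (g : Fin k → C → ℝ) :
    𝔼 v : Fin k → C, ∏ j, g j (v j) = ∏ j, 𝔼 c, g j c := by
  classical
  simp_rw [Fintype.expect_eq_sum_div_card]
  rw [Finset.prod_div_distrib, Finset.prod_univ_sum, Fintype.piFinset_univ]
  simp

theorem expect_pi_eval {C : Type*} [Fintype C] [Nonempty C] {k : ℕ} (f : C → ℝ) (j : Fin k) :
    𝔼 v : Fin k → C, f (v j) = 𝔼 c, f c := by
  have h := expect_pi_prod (fun l c => if l = j then f c else 1 : Fin k → C → ℝ)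
  have e : ∀ l, (𝔼 c, if l = j then f c else 1) = if l = j then 𝔼 c, f c else 1 := by
    intro l; split_ifs <;> simp
  simpa [e] using h

theorem expect_pi_pow {C : Type*} [Fintype C] [Nonempty C] {k : ℕ} (f : C → ℝ) :
    𝔼 v : Fin k → C, ∏ j, f (v j) = (𝔼 c, f c) ^ k := by
  rw [expect_pi_prod]; simp

theorem expect_intUnits (f : ℤˣ → ℝ) : 𝔼 s, f s = (f 1 + f (-1)) / 2 := by
  have : (univ : Finset ℤˣ) = {1, -1} := rfl
  rw [Fintype.expect_eq_sum_div_card, this, Finset.sum_pair (by decide)]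
  simp

variable {k n : ℕ}

/-- The weight `1 - a ∑ y - b ∏ (1 - y)` of a clause whose literals have the values `y`. -/
def weight (a b : ℝ) (y : Fin k → ℤˣ) : ℝ :=
  1 - a * ∑ j, ((y j : ℤ) : ℝ) - b * ∏ j, (1 - ((y j : ℤ) : ℝ))

theorem intUnits_mul_self (u : ℤˣ) : ((u : ℤ) : ℝ) * ((u : ℤ) : ℝ) = 1 := by
  rcases Int.units_eq_one_or u with rfl | rfl <;> simp

theorem expect_sum_signs (ρ : Fin k → ℝ) :
    𝔼 s : Fin k → ℤˣ, ∑ j, ((s j : ℤ) : ℝ) * ρ j = 0 := by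
  rw [Finset.expect_sum_comm]
  refine Finset.sum_eq_zero fun j _ => ?_
  rw [← Finset.expect_mul, expect_pi_eval (fun u : ℤˣ => ((u : ℤ) : ℝ)) j, expect_intUnits]
  simp

theorem expect_sign_mul_sign (i j : Fin k) :
    𝔼 s : Fin k → ℤˣ, ((s i : ℤ) : ℝ) * ((s j : ℤ) : ℝ) = if i = j then 1 else 0 := by
  split_ifs with h
  · subst h; simp [intUnits_mul_self]
  · have h2 := expect_pi_prod (fun l (u : ℤˣ) => (if l = i then ((u : ℤ) : ℝ) else 1) *
      (if l = j then ((u : ℤ) : ℝ) else 1) : Fin k → ℤˣ → ℝ)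
    simp only [Finset.prod_mul_distrib, Finset.prod_ite_eq', Finset.mem_univ, if_true] at h2
    rw [h2]
    refine Finset.prod_eq_zero (Finset.mem_univ i) ?_
    rw [expect_intUnits]
    simp [h]

theorem expect_sum_mul_sum_signs (ρ : Fin k → ℝ) :
    𝔼 s : Fin k → ℤˣ, (∑ j, ((s j : ℤ) : ℝ)) * ∑ j, ((s j : ℤ) : ℝ) * ρ j = ∑ j, ρ j := by
  simp_rw [Finset.sum_mul_sum, ← mul_assoc]
  rw [Finset.expect_sum_comm]
  simp_rw [Finset.expect_sum_comm, ← Finset.expect_mul, expect_sign_mul_sign]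
  simp

/-- The product vanishes unless every `y j` is `-1`, and there the sum equals `-∑ ρ`. -/
theorem prod_one_sub_mul_sum (y ρ : Fin k → ℤˣ) :
    (∏ j, (1 - ((y j : ℤ) : ℝ))) * ∑ j, ((y j : ℤ) : ℝ) * ((ρ j : ℤ) : ℝ)
      = -(∑ j, ((ρ j : ℤ) : ℝ)) * ∏ j, (1 - ((y j : ℤ) : ℝ)) := by
  rw [neg_mul, mul_comm (∑ j, _), Finset.mul_sum, Finset.mul_sum, ← Finset.sum_neg_distrib]
  refine Finset.sum_congr rfl fun j _ => ?_
  rw [← Finset.mul_prod_erase univ _ (Finset.mem_univ j)]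
  linear_combination (-(((ρ j : ℤ) : ℝ)) * ∏ x ∈ univ.erase j, (1 - ((y x : ℤ) : ℝ)))
    * intUnits_mul_self (y j)

theorem prod_one_sub_mul_sum' (y ρ : Fin k → ℤˣ) :
    (∏ j, (1 - ((y j : ℤ) : ℝ) * ((ρ j : ℤ) : ℝ))) * ∑ j, ((y j : ℤ) : ℝ)
      = -(∑ j, ((ρ j : ℤ) : ℝ)) * ∏ j, (1 - ((y j : ℤ) : ℝ) * ((ρ j : ℤ) : ℝ)) := by
  have h := prod_one_sub_mul_sum (fun j => y j * ρ j) ρ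
  simp only [Units.val_mul, Int.cast_mul] at h
  rw [← h]
  congr 1
  refine Finset.sum_congr rfl fun j _ => ?_
  rw [mul_assoc, intUnits_mul_self, mul_one]

theorem expect_weight_mul_weight (a b a' b' : ℝ) (ρ : Fin k → ℤˣ) :
    𝔼 y : Fin k → ℤˣ, weight a b y * weight a' b' (y * ρ)
      = 1 - b - b' + (a * a' - a * b' - a' * b) * ∑ j, ((ρ j : ℤ) : ℝ)
        + b * b' * ∏ j, (1 + ((ρ j : ℤ) : ℝ)) := by
  have e1 : 𝔼 y : Fin k → ℤˣ, ∑ j, ((y j : ℤ) : ℝ) = 0 := by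
    simpa using expect_sum_signs (k := k) fun _ => 1
  have e2 := expect_sum_signs fun j => ((ρ j : ℤ) : ℝ)
  have e3 : 𝔼 y : Fin k → ℤˣ, ∏ j, (1 - ((y j : ℤ) : ℝ)) = 1 := by
    rw [expect_pi_pow fun u : ℤˣ => 1 - ((u : ℤ) : ℝ), expect_intUnits]
    simp
  have e4 : 𝔼 y : Fin k → ℤˣ, ∏ j, (1 - ((y j : ℤ) : ℝ) * ((ρ j : ℤ) : ℝ)) = 1 := by
    rw [expect_pi_prod fun j (u : ℤˣ) => 1 - ((u : ℤ) : ℝ) * ((ρ j : ℤ) : ℝ)]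
    refine Finset.prod_eq_one fun j _ => ?_
    rw [expect_intUnits]
    simp
  have e5 := expect_sum_mul_sum_signs fun j => ((ρ j : ℤ) : ℝ)
  have e6 : 𝔼 y : Fin k → ℤˣ, (∏ j, (1 - ((y j : ℤ) : ℝ)))
      * ∏ j, (1 - ((y j : ℤ) : ℝ) * ((ρ j : ℤ) : ℝ)) = ∏ j, (1 + ((ρ j : ℤ) : ℝ)) := by
    simp_rw [← Finset.prod_mul_distrib]
    rw [expect_pi_prod fun j (u : ℤˣ) =>
      (1 - ((u : ℤ) : ℝ)) * (1 - ((u : ℤ) : ℝ) * ((ρ j : ℤ) : ℝ))]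
    refine Finset.prod_congr rfl fun j _ => ?_
    rw [expect_intUnits]
    simp
    ring
  have key : ∀ y : Fin k → ℤˣ, weight a b y * weight a' b' (y * ρ)
      = 1 - a * ∑ j, ((y j : ℤ) : ℝ) - (b + a' * b * -∑ j, ((ρ j : ℤ) : ℝ)
            - 2 * (a' * b * -∑ j, ((ρ j : ℤ) : ℝ))) * ∏ j, (1 - ((y j : ℤ) : ℝ))
          - a' * ∑ j, ((y j : ℤ) : ℝ) * ((ρ j : ℤ) : ℝ)
          - (b' - a * b' * -∑ j, ((ρ j : ℤ) : ℝ))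
            * ∏ j, (1 - ((y j : ℤ) : ℝ) * ((ρ j : ℤ) : ℝ))
          + a * a' * ((∑ j, ((y j : ℤ) : ℝ)) * ∑ j, ((y j : ℤ) : ℝ) * ((ρ j : ℤ) : ℝ))
          + b * b' * ((∏ j, (1 - ((y j : ℤ) : ℝ)))
            * ∏ j, (1 - ((y j : ℤ) : ℝ) * ((ρ j : ℤ) : ℝ))) := by
    intro y
    have h1 := prod_one_sub_mul_sum y ρ
    have h2 := prod_one_sub_mul_sum' y ρ
    simp only [weight, Pi.mul_apply, Units.val_mul, Int.cast_mul]
    linear_combination a' * b * h1 + a * b' * h2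
  simp_rw [key]
  simp only [Finset.expect_add_distrib, Finset.expect_sub_distrib, ← Finset.mul_expect,
    Fintype.expect_const, e1, e2, e3, e4, e5, e6]
  ring

/-- The truth values `±1` of the literals of a clause. -/
def literals (c : Clause k n) (σ : Assignment n) : Fin k → ℤˣ := fun j => c.sign j * σ (c.var j)

/-- A clause is a choice of variables and a choice of signs. -/
def clauseEquiv (k n : ℕ) : Clause k n ≃ (Fin k ↪ Fin n) × (Fin k → ℤˣ) where
  toFun c := (c.var, c.sign)
  invFun p := ⟨p.1, p.2⟩
  left_inv _ := rfl
  right_inv _ := rfl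

instance : Fintype (Clause k n) := Fintype.ofEquiv _ (clauseEquiv k n).symm

theorem expect_clause (f : Clause k n → ℝ) :
    𝔼 c, f c = 𝔼 v : Fin k ↪ Fin n, 𝔼 s : Fin k → ℤˣ, f ⟨v, s⟩ := by
  rw [← Finset.expect_product' (s := univ) (t := univ)
    (f := fun (v : Fin k ↪ Fin n) (s : Fin k → ℤˣ) => f ⟨v, s⟩), Finset.univ_product_univ]
  exact Fintype.expect_equiv (clauseEquiv k n) _ _ fun _ => rfl

theorem expect_clause_weight_mul_weight (a b a' b' : ℝ) (σ τ : Assignment n) :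
    𝔼 c : Clause k n, weight a b (literals c σ) * weight a' b' (literals c τ)
      = 𝔼 v : Fin k ↪ Fin n, (1 - b - b' + (a * a' - a * b' - a' * b) *
          ∑ j, (((σ (v j) * τ (v j) : ℤˣ) : ℤ) : ℝ)
        + b * b' * ∏ j, (1 + (((σ (v j) * τ (v j) : ℤˣ) : ℤ) : ℝ))) := by
  rw [expect_clause]
  refine Finset.expect_congr rfl fun v _ => ?_
  rw [← expect_weight_mul_weight a b a' b' fun j => σ (v j) * τ (v j)]
  -- For uniform signs the literal values under `σ` are uniform, and those under `τ` differ from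
  -- them by the factor `ρ = σ * τ`.
  refine Fintype.expect_equiv (Equiv.mulRight fun j => σ (v j)) _ _ fun s => ?_
  congr 2
  ext j
  simp only [literals, Equiv.coe_mulRight, Pi.mul_apply]
  rw [mul_assoc, ← mul_assoc (σ (v j)), Int.units_mul_self, one_mul]

theorem expect_clause_weight_mul_weight_self (hkn : k ≤ n) (a b a' b' : ℝ) (σ : Assignment n) :
    𝔼 c : Clause k n, weight a b (literals c σ) * weight a' b' (literals c σ)
      = 1 - b - b' + (a * a' - a * b' - a' * b) * k + b * b' * 2 ^ k := by
  have : Nonempty (Fin k ↪ Fin n) := ⟨Fin.castLEEmb hkn⟩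
  rw [expect_clause_weight_mul_weight]
  simp [one_add_one_eq_two]

theorem expect_clause_weight (hkn : k ≤ n) (a b : ℝ) (σ : Assignment n) :
    𝔼 c : Clause k n, weight a b (literals c σ) = 1 - b := by
  have := expect_clause_weight_mul_weight_self hkn a b 0 0 σ
  simpa [weight] using this

theorem pow_le_exp_mul_descFactorial (hkn : 2 * k ≤ n) (hn : 0 < n) :
    (n : ℝ) ^ k ≤ Real.exp (2 * k ^ 2 / n) * n.descFactorial k := by
  have h1 : ((n - k : ℕ) : ℝ) ^ k ≤ n.descFactorial k := by
    have := Nat.pow_sub_le_descFactorial n k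
    have h2 : (n - k) ^ k ≤ (n + 1 - k) ^ k := Nat.pow_le_pow_left (by omega) k
    exact_mod_cast h2.trans this
  have h2 : (n : ℝ) ≤ Real.exp (2 * k / n) * ((n - k : ℕ) : ℝ) := by
    have hnR : (0 : ℝ) < n := by exact_mod_cast hn
    have hk2 : 2 * (k : ℝ) ≤ n := by exact_mod_cast hkn
    rw [Nat.cast_sub (by omega)]
    have := Real.add_one_le_exp (2 * (k : ℝ) / n)
    have h3 : (n : ℝ) ≤ (2 * (k : ℝ) / n + 1) * (n - k) := by
      rw [← sub_nonneg]
      have : (2 * (k : ℝ) / n + 1) * (n - k) - n = k * (n - 2 * k) / n := by field_simp; ring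
      rw [this]
      exact div_nonneg (mul_nonneg (Nat.cast_nonneg k) (by linarith)) hnR.le
    refine h3.trans (mul_le_mul_of_nonneg_right this ?_)
    linarith [(Nat.cast_nonneg k : (0 : ℝ) ≤ k)]
  calc (n : ℝ) ^ k ≤ (Real.exp (2 * k / n) * ((n - k : ℕ) : ℝ)) ^ k :=
        pow_le_pow_left₀ (Nat.cast_nonneg n) h2 k
    _ = Real.exp (2 * k ^ 2 / n) * ((n - k : ℕ) : ℝ) ^ k := by
        rw [mul_pow, ← Real.exp_nat_mul]; congr 2; ring
    _ ≤ _ := by gcongr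

/-- Sampling without replacement against sampling with replacement. -/
theorem expect_embedding_le (hkn : 2 * k ≤ n) (hn : 0 < n) (g : (Fin k → Fin n) → ℝ)
    (hg : ∀ v, 0 ≤ g v) :
    𝔼 v : Fin k ↪ Fin n, g v ≤ Real.exp (2 * k ^ 2 / n) * 𝔼 v : Fin k → Fin n, g v := by
  classical
  have hnR : (0 : ℝ) < n := by exact_mod_cast hn
  have hD : (0 : ℝ) < n.descFactorial k := by
    exact_mod_cast Nat.pos_of_ne_zero (by
      rw [Ne, Nat.descFactorial_eq_zero_iff_lt]; omega)
  have hsum : ∑ v : Fin k ↪ Fin n, g v ≤ ∑ v : Fin k → Fin n, g v := by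
    have e := Finset.sum_map univ (⟨fun v : Fin k ↪ Fin n => (v : Fin k → Fin n),
      DFunLike.coe_injective⟩ : (Fin k ↪ Fin n) ↪ (Fin k → Fin n)) g
    refine e.symm.le.trans ?_
    exact Finset.sum_le_sum_of_subset_of_nonneg (Finset.subset_univ _) fun v _ _ => hg v
  rw [Fintype.expect_eq_sum_div_card, Fintype.expect_eq_sum_div_card, Fintype.card_embedding_eq]
  simp only [Fintype.card_fun, Fintype.card_fin, Nat.cast_pow]
  have h0 : 0 ≤ ∑ v : Fin k → Fin n, g v := Finset.sum_nonneg fun v _ => hg v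
  rw [mul_div_assoc', div_le_div_iff₀ hD (by positivity)]
  calc _ ≤ (∑ v : Fin k → Fin n, g v) * (Real.exp (2 * k ^ 2 / n) * n.descFactorial k) := by
        gcongr
        exact pow_le_exp_mul_descFactorial hkn hn
    _ = _ := by ring

theorem sum_mul_eq_sub_hammingDist (σ τ : Assignment n) :
    ∑ i, (((σ i * τ i : ℤˣ) : ℤ) : ℝ) = n - 2 * hammingDist σ τ := by
  have : ∀ i, (((σ i * τ i : ℤˣ) : ℤ) : ℝ) = 1 - 2 * if σ i ≠ τ i then 1 else 0 := by
    intro i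
    rcases Int.units_eq_one_or (σ i) with h | h <;> rcases Int.units_eq_one_or (τ i) with h' | h' <;>
      simp [h, h'] <;> norm_num [Units.ext_iff]
  simp_rw [this, Finset.sum_sub_distrib, ← Finset.mul_sum, Finset.sum_boole]
  simp [hammingDist]

theorem expect_clause_weight_mul_weight_le (hkn : 2 * k ≤ n) (hn : 0 < n) (a b : ℝ)
    (hw : ∀ y : Fin k → ℤˣ, 0 ≤ weight a b y) (σ τ : Assignment n) :
    𝔼 c : Clause k n, weight a b (literals c σ) * weight a b (literals c τ)
      ≤ Real.exp (2 * k ^ 2 / n) * (1 - 2 * b + (a ^ 2 - 2 * a * b) *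
          (k * (1 - 2 * (hammingDist σ τ / n))) + b ^ 2 * (2 ^ k * (1 - hammingDist σ τ / n) ^ k)) := by
  have : Nonempty (Fin n) := ⟨⟨0, hn⟩⟩
  have hnR : (n : ℝ) ≠ 0 := by exact_mod_cast hn.ne'
  have hα : 𝔼 i : Fin n, (((σ i * τ i : ℤˣ) : ℤ) : ℝ) = 1 - 2 * (hammingDist σ τ / n) := by
    rw [Fintype.expect_eq_sum_div_card, sum_mul_eq_sub_hammingDist]
    simp; field_simp
  rw [expect_clause_weight_mul_weight]
  refine (expect_embedding_le hkn hn (fun v => 1 - b - b + (a * a - a * b - a * b) *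
          ∑ j, (((σ (v j) * τ (v j) : ℤˣ) : ℤ) : ℝ)
        + b * b * ∏ j, (1 + (((σ (v j) * τ (v j) : ℤˣ) : ℤ) : ℝ))) fun v => ?_).trans (le_of_eq ?_)
  · rw [← expect_weight_mul_weight a b a b fun j => σ (v j) * τ (v j)]
    exact Finset.expect_nonneg fun y _ => mul_nonneg (hw _) (hw _)
  · congr 1
    rw [Finset.expect_add_distrib, Finset.expect_add_distrib, ← Finset.mul_expect,
      ← Finset.mul_expect, Fintype.expect_const, Finset.expect_sum_comm,
      expect_pi_pow fun i : Fin n => 1 + (((σ i * τ i : ℤˣ) : ℤ) : ℝ)]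
    simp_rw [expect_pi_eval fun i : Fin n => (((σ i * τ i : ℤˣ) : ℤ) : ℝ)]
    rw [Finset.expect_add_distrib, Fintype.expect_const, hα, ← mul_pow]
    simp only [Finset.sum_const, Finset.card_univ, Fintype.card_fin, nsmul_eq_mul]
    ring

end ClauseAverages

/-! ### Pair moments graded by Hamming distance. -/

section PairMoments

open Finset
open scoped BigOperators

variable {k n : ℕ}

theorem pow_eq_exp_mul_log {p : ℝ} {j : ℕ} (hp : 0 ≤ p) (h : p = 0 → j = 0) :
    p ^ j = Real.exp (-(j * Real.log p⁻¹)) := by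
  rcases hp.eq_or_lt with rfl | hp
  · simp [h rfl]
  · rw [Real.log_inv, mul_neg, neg_neg, Real.exp_nat_mul, Real.exp_log hp]

/-- Flip each coordinate of `σ` independently with probability `j / n`: every `τ` at distance `j`
then has probability `exp (-n * H(j / n))`, and the total is at most one. -/
theorem card_hammingDist_eq_le (hn : 0 < n) (σ : Assignment n) {j : ℕ} (hj : j ≤ n) :
    (#{τ : Assignment n | hammingDist σ τ = j} : ℝ) ≤ Real.exp (n * Real.binEntropy (j / n)) := by
  classical
  have hnR : (0 : ℝ) < n := by exact_mod_cast hn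
  have hjR : (j : ℝ) ≤ n := by exact_mod_cast hj
  set p : ℝ := j / n with hp
  have hp0 : 0 ≤ p := by positivity
  have hp1 : p ≤ 1 := by rw [hp, div_le_one hnR]; exact hjR
  have hnp : n * p = j := by rw [hp]; field_simp
  have htot : ∑ τ : Assignment n, ∏ i, (if σ i ≠ τ i then p else 1 - p) = 1 := by
    have h := Finset.prod_univ_sum (fun _ : Fin n => (univ : Finset ℤˣ))
      (fun i u => if σ i ≠ u then p else 1 - p)
    rw [Fintype.piFinset_univ] at h
    rw [← h]
    refine Finset.prod_eq_one fun i _ => ?_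
    have : (univ : Finset ℤˣ) = {1, -1} := rfl
    rw [this, Finset.sum_pair (by decide)]
    rcases Int.units_eq_one_or (σ i) with h | h <;> simp [h]
  have hval : ∀ τ : Assignment n, hammingDist σ τ = j →
      ∏ i, (if σ i ≠ τ i then p else 1 - p) = Real.exp (-(n * Real.binEntropy p)) := by
    intro τ hτ
    rw [Finset.prod_ite, Finset.prod_const, Finset.prod_const]
    have h1 : #{i | σ i ≠ τ i} = j := hτ
    have h2 : #{i | ¬σ i ≠ τ i} = n - j := by
      have := Finset.card_filter_add_card_filter_not (s := (univ : Finset (Fin n)))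
        (fun i => σ i ≠ τ i)
      rw [h1, Finset.card_univ, Fintype.card_fin] at this
      omega
    rw [h1, h2, pow_eq_exp_mul_log hp0, pow_eq_exp_mul_log (sub_nonneg.2 hp1), ← Real.exp_add,
      Nat.cast_sub hj, Real.binEntropy, ← hnp]
    · ring_nf
    · intro h
      have : (j : ℝ) = n := by rw [← hnp]; nlinarith
      have : j = n := by exact_mod_cast this
      omega
    · intro h
      have : (j : ℝ) = 0 := by rw [← hnp, h, mul_zero]
      exact_mod_cast this
  have hle : (#{τ : Assignment n | hammingDist σ τ = j} : ℝ) * Real.exp (-(n * Real.binEntropy p))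
      ≤ 1 := by
    rw [← htot, ← nsmul_eq_mul, ← Finset.sum_const]
    rw [Finset.sum_congr rfl fun τ hτ => (hval τ (by simpa using hτ)).symm]
    refine Finset.sum_le_sum_of_subset_of_nonneg (Finset.subset_univ _) fun τ _ _ => ?_
    refine Finset.prod_nonneg fun i _ => ?_
    split_ifs <;> linarith
  rw [Real.exp_neg, ← div_eq_mul_inv, div_le_one (Real.exp_pos _)] at hle
  exact hle

/-- The first order Laplace method for sums over pairs of assignments. -/
theorem sum_sum_hammingDist_le (hn : 0 < n) (φ : ℕ → ℝ) {K : ℝ} (hK : 0 ≤ K)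
    (hφ : ∀ j ≤ n, φ j ≤ K * Real.exp (n * (Real.log 2 - Real.binEntropy (j / n)))) :
    ∑ σ : Assignment n, ∑ τ : Assignment n, φ (hammingDist σ τ) ≤ 4 ^ n * (n + 1) * K := by
  have hσ : ∀ σ : Assignment n, ∑ τ : Assignment n, φ (hammingDist σ τ) ≤ 2 ^ n * (n + 1) * K := by
    intro σ
    have hmaps : ∀ τ ∈ (univ : Finset (Assignment n)), hammingDist σ τ ∈ Finset.range (n + 1) := by
      intro τ _
      have := hammingDist_le_card_fintype (x := σ) (y := τ)
      rw [Fintype.card_fin] at this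
      rw [Finset.mem_range]; omega
    rw [← Finset.sum_fiberwise_of_maps_to hmaps]
    have hj : ∀ j ∈ Finset.range (n + 1),
        ∑ τ with hammingDist σ τ = j, φ (hammingDist σ τ) ≤ 2 ^ n * K := by
      intro j hj
      have hj' : j ≤ n := by rw [Finset.mem_range] at hj; omega
      rw [Finset.sum_congr rfl (g := fun _ => φ j)
        (fun τ hτ => by rw [(Finset.mem_filter.1 hτ).2]), Finset.sum_const, nsmul_eq_mul]
      have hc := card_hammingDist_eq_le hn σ hj'
      calc _ ≤ (#{τ : Assignment n | hammingDist σ τ = j} : ℝ) *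
            (K * Real.exp (n * (Real.log 2 - Real.binEntropy (j / n)))) :=
            mul_le_mul_of_nonneg_left (hφ j hj') (Nat.cast_nonneg _)
        _ ≤ Real.exp (n * Real.binEntropy (j / n)) *
            (K * Real.exp (n * (Real.log 2 - Real.binEntropy (j / n)))) :=
            mul_le_mul_of_nonneg_right hc (by positivity)
        _ = Real.exp (n * Real.binEntropy (j / n) +
            n * (Real.log 2 - Real.binEntropy (j / n))) * K := by rw [Real.exp_add]; ring
        _ = 2 ^ n * K := by
            rw [← mul_add, add_sub_cancel, Real.exp_nat_mul, Real.exp_log two_pos]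
    refine (Finset.sum_le_sum hj).trans (le_of_eq ?_)
    rw [Finset.sum_const, Finset.card_range, nsmul_eq_mul]
    push_cast; ring
  refine (Finset.sum_le_sum fun σ _ => hσ σ).trans (le_of_eq ?_)
  rw [Finset.sum_const, nsmul_eq_mul, Finset.card_univ, Fintype.card_fun, Fintype.card_fin,
    Fintype.card_units_int]
  push_cast
  rw [show (4 : ℝ) = 2 * 2 by norm_num, mul_pow]
  ring

theorem expect_sum_prod_weight (hkn : k ≤ n) (a b : ℝ) (m : ℕ) :
    𝔼 x : Fin m → Clause k n, ∑ σ : Assignment n, ∏ i, weight a b (literals (x i) σ)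
      = 2 ^ n * (1 - b) ^ m := by
  have : Nonempty (Clause k n) := ⟨⟨Fin.castLEEmb hkn, fun _ => 1⟩⟩
  rw [Finset.expect_sum_comm]
  have h : ∀ σ : Assignment n, 𝔼 x : Fin m → Clause k n, ∏ i, weight a b (literals (x i) σ)
      = (1 - b) ^ m := fun σ => by
    rw [expect_pi_pow fun c : Clause k n => weight a b (literals c σ), expect_clause_weight hkn]
  simp_rw [h]
  rw [Finset.sum_const, nsmul_eq_mul, Finset.card_univ, Fintype.card_fun, Fintype.card_fin,
    Fintype.card_units_int]
  push_cast
  rfl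

open Classical in
/-- The second moment of a weighted partition function, restricted by the overlap. -/
theorem expect_pair_le (hkn : 2 * k ≤ n) (hn : 0 < n) {a b θ M Δ : ℝ}
    (hw : ∀ y : Fin k → ℤˣ, 0 ≤ weight a b y) {m : ℕ} (hm : (m : ℝ) ≤ M * n)
    (P : ℕ → Prop) (B : ℝ → ℝ)
    (hB0 : ∀ j ≤ n, P j → 0 ≤ B (j / n))
    (hB : ∀ j ≤ n, P j → 1 - 2 * b + (a ^ 2 - 2 * a * b) * (k * (1 - 2 * (j / n)))
      + b ^ 2 * (2 ^ k * (1 - (j : ℝ) / n) ^ k) ≤ θ ^ 2 * Real.exp (B (j / n)))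
    (hMB : ∀ j ≤ n, P j → M * B (j / n) ≤ Real.log 2 - Real.binEntropy (j / n) - Δ) :
    𝔼 x : Fin m → Clause k n, ∑ σ : Assignment n, ∑ τ : Assignment n,
      (if P (hammingDist σ τ) then (∏ i, weight a b (literals (x i) σ)) *
        ∏ i, weight a b (literals (x i) τ) else 0)
      ≤ 4 ^ n * (n + 1) * (Real.exp (2 * k ^ 2 * M) * θ ^ (2 * m) * Real.exp (-(n * Δ))) := by
  have hnR : (0 : ℝ) < n := by exact_mod_cast hn
  have : Nonempty (Clause k n) := ⟨⟨Fin.castLEEmb (by omega), fun _ => 1⟩⟩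
  have hM0 : 0 ≤ M * n := (Nat.cast_nonneg m).trans hm
  rw [Finset.expect_sum_comm]
  simp_rw [Finset.expect_sum_comm]
  set K := Real.exp (2 * k ^ 2 * M) * θ ^ (2 * m) * Real.exp (-(n * Δ)) with hK
  have hθ : 0 ≤ θ ^ (2 * m) := by rw [pow_mul]; positivity
  have hK0 : 0 ≤ K := by positivity
  refine le_trans ?_ (sum_sum_hammingDist_le hn (fun j => if P j then K *
    Real.exp (n * (Real.log 2 - Real.binEntropy (j / n))) else 0) hK0 fun j hj => ?_)
  · refine Finset.sum_le_sum fun σ _ => Finset.sum_le_sum fun τ _ => ?_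
    have hj : hammingDist σ τ ≤ n := by
      simpa using hammingDist_le_card_fintype (x := σ) (y := τ)
    by_cases hP : P (hammingDist σ τ)
    · simp only [hP, if_true, ← Finset.prod_mul_distrib]
      rw [expect_pi_pow fun c : Clause k n =>
        weight a b (literals c σ) * weight a b (literals c τ)]
      have h1 := expect_clause_weight_mul_weight_le hkn hn a b hw σ τ
      have h2 := h1.trans (mul_le_mul_of_nonneg_left (hB _ hj hP) (Real.exp_pos _).le)
      have h0 : 0 ≤ 𝔼 c : Clause k n, weight a b (literals c σ) * weight a b (literals c τ) :=
        Finset.expect_nonneg fun c _ => mul_nonneg (hw _) (hw _)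
      have hB0' := hB0 _ hj hP
      have hMB' := hMB _ hj hP
      generalize (hammingDist σ τ : ℝ) / n = x at *
      calc _ ≤ (Real.exp (2 * k ^ 2 / n) * (θ ^ 2 * Real.exp (B x))) ^ m :=
            pow_le_pow_left₀ h0 h2 m
        _ = Real.exp (m * (2 * k ^ 2 / n)) * θ ^ (2 * m) * Real.exp (m * B x) := by
            rw [mul_pow, mul_pow, ← Real.exp_nat_mul, ← Real.exp_nat_mul, pow_mul]; ring
        _ ≤ Real.exp (2 * k ^ 2 * M) * θ ^ (2 * m) *
            Real.exp (-(n * Δ) + n * (Real.log 2 - Real.binEntropy x)) := by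
            -- Sampling without replacement costs `exp (2 * k ^ 2 / n)` per clause, hence only a
            -- constant over at most `M * n` clauses.
            have e1 : m * (2 * (k : ℝ) ^ 2 / n) ≤ 2 * k ^ 2 * M := by
              rw [mul_div_assoc', div_le_iff₀ hnR]
              have := mul_le_mul_of_nonneg_left hm (by positivity : 0 ≤ 2 * (k : ℝ) ^ 2)
              linarith
            -- Nonnegativity of `B` permits replacing `m` by its upper bound `M * n`.
            have e2 : m * B x ≤ -(n * Δ) + n * (Real.log 2 - Real.binEntropy x) := by
              have h3 := mul_le_mul_of_nonneg_right hm hB0'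
              have h4 := mul_le_mul_of_nonneg_left hMB' hnR.le
              linarith
            refine mul_le_mul (mul_le_mul_of_nonneg_right (Real.exp_le_exp.2 e1) hθ)
              (Real.exp_le_exp.2 e2) (Real.exp_pos _).le (by positivity)
        _ = _ := by rw [Real.exp_add]; ring
    · simp [hP]
  · by_cases hP : P j
    · simp [hP]
    · simp only [hP, if_false]; positivity

end PairMoments

/-! ### Balanced weights, lower bound on `Z`, and rarity of large overlaps. -/

section SecondMoment

open Finset
open scoped BigOperators

variable {k n : ℕ}

theorem weight_zero_of_exists (b : ℝ) {y : Fin k → ℤˣ} (h : ∃ j, y j = 1) : weight 0 b y = 1 := by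
  obtain ⟨j, hj⟩ := h
  have : ∏ j, (1 - ((y j : ℤ) : ℝ)) = 0 :=
    Finset.prod_eq_zero (Finset.mem_univ j) (by simp [hj])
  simp [weight, this]

theorem weight_zero_of_forall (b : ℝ) {y : Fin k → ℤˣ} (h : ¬∃ j, y j = 1) :
    weight 0 b y = 1 - b * 2 ^ k := by
  push Not at h
  have h' : ∀ j, y j = -1 := fun j => (Int.units_eq_one_or (y j)).resolve_left (h j)
  simp [weight, h', one_add_one_eq_two]

/-- The cross term of the product lives on violated clauses, where `∑ y = -k`; the relation between
`ε` and `b` makes the coefficients of the violation terms agree. -/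
theorem weight_eq_mul {b ε : ℝ} (hε : ε * (1 - k * b) = b) (y : Fin k → ℤˣ) :
    weight ε ε y = weight 0 b y * weight ε 0 y := by
  have h := prod_one_sub_mul_sum y fun _ => 1
  simp only [Units.val_one, Int.cast_one, mul_one, Finset.sum_const, Finset.card_univ,
    Fintype.card_fin, nsmul_eq_mul] at h
  simp only [weight]
  linear_combination (-ε * b) * h + (-∏ j, (1 - ((y j : ℤ) : ℝ))) * hε

theorem abs_sum_signs_le (y : Fin k → ℤˣ) : |∑ j, ((y j : ℤ) : ℝ)| ≤ k := by
  refine (Finset.abs_sum_le_sum_abs _ _).trans ?_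
  have : ∀ j, |((y j : ℤ) : ℝ)| = 1 := fun j => by
    rcases Int.units_eq_one_or (y j) with h | h <;> simp [h]
  simp [this]

theorem weight_right_zero_nonneg {ε : ℝ} (h0 : 0 ≤ ε) (h1 : ε * k ≤ 1) (y : Fin k → ℤˣ) :
    0 ≤ weight ε 0 y := by
  have := (abs_le.1 (abs_sum_signs_le y)).2
  have := mul_le_mul_of_nonneg_left this h0
  simp only [weight]
  linarith

/-- The weights of the violated clauses and of their balanced version, for clauses of length `k`
at inverse temperature `β`. -/
structure BalancedWeights (k : ℕ) (β b ε : ℝ) : Prop where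
  beta_pos : 0 < β
  b_mul : b * 2 ^ k = 1 - Real.exp (-β)
  b_pos : 0 < b
  eps_mul : ε * (1 - k * b) = b
  eps_pos : 0 < ε
  eps_mul_le : ε * k ≤ 1
  eps_lt : ε < 1
  ratio_le : (ε / (1 - ε)) ^ 2 ≤ (1 / (2 ^ k - k - 1 : ℝ)) ^ 2

theorem exists_balancedWeights {q β : ℝ} (hk : LargeLength k q) (hβ : 0 < β) :
    ∃ b ε, BalancedWeights k β b ε := by
  have hkR : (200 : ℝ) ≤ k := by exact_mod_cast hk.two_hundred_le
  have hcube := hk.cube_le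
  have hN1 : 100 * (k : ℝ) ≤ 2 ^ k := by nlinarith
  set N : ℝ := 2 ^ k with hN
  have hN0 : 0 < N := by linarith
  set c := 1 - Real.exp (-β) with hc
  have hc0 : 0 < c := by
    have : Real.exp (-β) < Real.exp 0 := Real.exp_lt_exp.2 (by linarith)
    rw [Real.exp_zero] at this
    linarith
  have hc1 : c ≤ 1 := by linarith [Real.exp_pos (-β)]
  have hck : c * k ≤ k := by nlinarith
  have hd : 0 < N - c * k := by linarith
  have hd2 : 0 < N - c * k - c := by linarith
  -- Both values are forced by `b_mul` and `eps_mul`. The ratio `ε / (1 - ε) = c / (N - c * k - c)`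
  -- is largest at `c = 1`, so the bound is uniform in `β`.
  refine ⟨c / N, c / (N - c * k), hβ, div_mul_cancel₀ c hN0.ne', by positivity, ?_,
    by positivity, ?_, ?_, ?_⟩
  · field_simp
  · rw [div_mul_eq_mul_div, div_le_one hd]; linarith
  · rw [div_lt_one hd]; linarith
  · have e : c / (N - c * k) / (1 - c / (N - c * k)) = c / (N - c * k - c) := by
      rw [one_sub_div hd.ne', div_div_div_cancel_right₀ hd.ne']
    rw [e]
    gcongr
    linarith

variable {β b ε : ℝ}

theorem weight_mem_Icc (hb : BalancedWeights k β b ε) (y : Fin k → ℤˣ) :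
    Real.exp (-β) ≤ weight 0 b y ∧ weight 0 b y ≤ 1 := by
  have h1 : Real.exp (-β) ≤ 1 := Real.exp_le_one_iff.2 (by linarith [hb.beta_pos])
  by_cases h : ∃ j, y j = 1
  · rw [weight_zero_of_exists b h]; exact ⟨h1, le_rfl⟩
  · rw [weight_zero_of_forall b h, hb.b_mul]
    exact ⟨by linarith, by linarith⟩

theorem weight_pos (hb : BalancedWeights k β b ε) (y : Fin k → ℤˣ) : 0 < weight 0 b y :=
  (Real.exp_pos _).trans_le (weight_mem_Icc hb y).1

theorem balanced_weight_nonneg (hb : BalancedWeights k β b ε) (y : Fin k → ℤˣ) :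
    0 ≤ weight ε ε y := by
  rw [weight_eq_mul hb.eps_mul]
  exact mul_nonneg (weight_pos hb y).le
    (weight_right_zero_nonneg hb.eps_pos.le hb.eps_mul_le y)

/-- The partition function as a function of the sequence of clauses. -/
def partitionSum (b : ℝ) {m : ℕ} (x : Fin m → Clause k n) : ℝ :=
  ∑ σ : Assignment n, ∏ i, weight 0 b (literals (x i) σ)

theorem partitionSum_pos (hb : BalancedWeights k β b ε) {m : ℕ} (x : Fin m → Clause k n) :
    0 < partitionSum b x :=
  Finset.sum_pos (fun _ _ => Finset.prod_pos fun _ _ => weight_pos hb _) univ_nonempty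

theorem partitionSum_le_of_update (hb : BalancedWeights k β b ε) {m : ℕ} (x : Fin m → Clause k n)
    (i : Fin m) (c : Clause k n) :
    partitionSum b x ≤ Real.exp β * partitionSum b (Function.update x i c) := by
  rw [partitionSum, partitionSum, Finset.mul_sum]
  refine Finset.sum_le_sum fun σ _ => ?_
  rw [← Finset.mul_prod_erase univ _ (Finset.mem_univ i),
    ← Finset.mul_prod_erase univ _ (Finset.mem_univ i), ← mul_assoc]
  have e : ∏ j ∈ univ.erase i, weight 0 b (literals (Function.update x i c j) σ)
      = ∏ j ∈ univ.erase i, weight 0 b (literals (x j) σ) :=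
    Finset.prod_congr rfl fun j hj => by rw [Function.update_of_ne (Finset.ne_of_mem_erase hj)]
  rw [e]
  refine mul_le_mul_of_nonneg_right ?_ (Finset.prod_nonneg fun _ _ => (weight_pos hb _).le)
  refine (weight_mem_Icc hb _).2.trans ?_
  have := mul_le_mul_of_nonneg_left
    (weight_mem_Icc hb (literals (Function.update x i c i) σ)).1 (Real.exp_pos β).le
  rwa [← Real.exp_add, add_neg_cancel, Real.exp_zero] at this

theorem abs_log_partitionSum_update_sub_le (hb : BalancedWeights k β b ε) {m : ℕ}
    (x : Fin m → Clause k n) (i : Fin m) (c : Clause k n) :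
    |Real.log (partitionSum b (Function.update x i c)) - Real.log (partitionSum b x)| ≤ β := by
  have h1 := Real.log_le_log (partitionSum_pos hb _) (partitionSum_le_of_update hb x i c)
  have h2 := Real.log_le_log (partitionSum_pos hb _)
    (partitionSum_le_of_update hb (Function.update x i c) i (x i))
  rw [Function.update_idem, Function.update_eq_self] at h2
  rw [Real.log_mul (Real.exp_ne_zero _) (partitionSum_pos hb _).ne', Real.log_exp] at h1 h2
  rw [abs_le]
  constructor <;> linarith

/-- The partition function of the balanced weights. -/
def balancedSum (ε : ℝ) {m : ℕ} (x : Fin m → Clause k n) : ℝ :=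
  ∑ σ : Assignment n, ∏ i, weight ε ε (literals (x i) σ)

/-- The balancing factor can exceed one, so the balanced sum need not lie below `Z`. Cauchy–Schwarz
with `weight ε ε = weight 0 b * weight ε 0` moves the excess into a sum of controllable mean. -/
theorem balancedSum_sq_le (hb : BalancedWeights k β b ε) {m : ℕ} (x : Fin m → Clause k n) :
    balancedSum ε x ^ 2 ≤ partitionSum b x *
      ∑ σ : Assignment n, ∏ i, (weight ε ε (literals (x i) σ) * weight ε 0 (literals (x i) σ)) := by
  refine Finset.sum_sq_le_sum_mul_sum_of_sq_le_mul _
    (fun σ _ => Finset.prod_nonneg fun _ _ => (weight_pos hb _).le)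
    (fun σ _ => Finset.prod_nonneg fun _ _ => mul_nonneg (balanced_weight_nonneg hb _)
      (weight_right_zero_nonneg hb.eps_pos.le hb.eps_mul_le _)) fun σ _ => le_of_eq ?_
  rw [← Finset.prod_mul_distrib, ← Finset.prod_pow]
  refine Finset.prod_congr rfl fun i _ => ?_
  rw [weight_eq_mul hb.eps_mul]; ring

/-- With `a = b = a' = ε` and `b' = 0` the coefficient of the linear term vanishes, so the mean is
exactly that of the balanced sum. -/
theorem expect_sum_prod_balanced_mul (hkn : k ≤ n) (m : ℕ) :
    𝔼 x : Fin m → Clause k n, ∑ σ : Assignment n,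
      ∏ i, (weight ε ε (literals (x i) σ) * weight ε 0 (literals (x i) σ))
      = 2 ^ n * (1 - ε) ^ m := by
  have : Nonempty (Clause k n) := ⟨⟨Fin.castLEEmb hkn, fun _ => 1⟩⟩
  rw [Finset.expect_sum_comm]
  have h : ∀ σ : Assignment n, 𝔼 x : Fin m → Clause k n,
      ∏ i, (weight ε ε (literals (x i) σ) * weight ε 0 (literals (x i) σ)) = (1 - ε) ^ m :=
    fun σ => by
      rw [expect_pi_pow fun c : Clause k n =>
        weight ε ε (literals c σ) * weight ε 0 (literals c σ),
        expect_clause_weight_mul_weight_self hkn]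
      congr 1; ring
  simp_rw [h]
  rw [Finset.sum_const, nsmul_eq_mul, Finset.card_univ, Fintype.card_fun, Fintype.card_fin,
    Fintype.card_units_int]
  push_cast
  rfl

variable {q : ℝ}

/-- The balanced weights have second moments of the order of the squared first moment. -/
theorem expect_balancedSum_sq_le (hk : LargeLength k q) (hb : BalancedWeights k β b ε)
    (hkn : 2 * k ≤ n) {m : ℕ} (hm : (m : ℝ) ≤ (2 ^ k * Real.log 2 - 10 * k) * n) :
    𝔼 x : Fin m → Clause k n, balancedSum ε x ^ 2
      ≤ (n + 1) * Real.exp (2 * k ^ 2 * (2 ^ k * Real.log 2 - 10 * k))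
        * (2 ^ n * (1 - ε) ^ m) ^ 2 := by
  have hk2 := hk.two_hundred_le
  have hn : 0 < n := by omega
  have hnR : (0 : ℝ) < n := by exact_mod_cast hn
  have hε1 : 0 < 1 - ε := by linarith [hb.eps_lt]
  set κ := (ε / (1 - ε)) ^ 2 with hκ
  have hκ0 : 0 ≤ κ := sq_nonneg _
  have hεκ : ε ^ 2 = (1 - ε) ^ 2 * κ := by rw [hκ, div_pow]; field_simp
  have hx : ∀ j ≤ n, (0 : ℝ) ≤ (j : ℝ) / n ∧ (j : ℝ) / n ≤ 1 := fun j hj =>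
    ⟨by positivity, by rw [div_le_one hnR]; exact_mod_cast hj⟩
  have h := expect_pair_le (a := ε) (b := ε) (θ := 1 - ε) (Δ := 0) hkn hn
    (balanced_weight_nonneg hb) hm (fun _ => True)
    (fun x => κ * (2 ^ k * (1 - x) ^ k - 1 - k * (1 - 2 * x)))
    (fun j hj _ => by
      obtain ⟨h0, h1⟩ := hx j hj
      refine mul_nonneg hκ0 ?_
      have := one_add_mul_le_pow (a := 1 - 2 * ((j : ℝ) / n)) (by linarith) k
      have e : 2 ^ k * (1 - (j : ℝ) / n) ^ k = (1 + (1 - 2 * ((j : ℝ) / n))) ^ k := by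
        rw [← mul_pow]; congr 1; ring
      rw [e]
      linarith)
    (fun j hj _ => by
      have := Real.add_one_le_exp
        (κ * (2 ^ k * (1 - (j : ℝ) / n) ^ k - 1 - k * (1 - 2 * ((j : ℝ) / n))))
      have := mul_le_mul_of_nonneg_left this (sq_nonneg (1 - ε))
      refine le_trans (le_of_eq ?_) this
      linear_combination (2 ^ k * (1 - (j : ℝ) / n) ^ k - 1 - k * (1 - 2 * ((j : ℝ) / n))) * hεκ)
    (fun j hj _ => by
      obtain ⟨h0, h1⟩ := hx j hj
      have := density_mul_balanced_le hk hκ0 hb.ratio_le h0 h1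
      linarith)
  refine le_trans (le_of_eq ?_) (h.trans (le_of_eq ?_))
  · refine Finset.expect_congr rfl fun x _ => ?_
    rw [balancedSum, sq, Finset.sum_mul_sum]
    simp
  · simp only [mul_zero, neg_zero, Real.exp_zero, mul_one]
    rw [mul_pow, ← pow_mul, ← pow_mul, mul_comm n 2, pow_mul 2 2 n, mul_comm m 2]
    norm_num
    ring

/-- The overlap of two samples is unlikely to be large, on the annealed scale. -/
theorem expect_large_overlap_le (hk : LargeLength k q) (hb : BalancedWeights k β b ε)
    (hkn : 2 * k ≤ n) {m : ℕ} (hm : (m : ℝ) ≤ (2 ^ k * Real.log 2 - 10 * k) * n) :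
    𝔼 x : Fin m → Clause k n, ∑ σ : Assignment n, ∑ τ : Assignment n,
      (if (hammingDist σ τ : ℝ) / n ≤ (1 - q) / 2 then
        (∏ i, weight 0 b (literals (x i) σ)) * ∏ i, weight 0 b (literals (x i) τ) else 0)
      ≤ (n + 1) * Real.exp (2 * k ^ 2 * (2 ^ k * Real.log 2 - 10 * k))
        * (2 ^ n * (1 - ε) ^ m) ^ 2 * Real.exp (-(n * (1 / 2 ^ k))) := by
  have hk2 := hk.two_hundred_le
  have hn : 0 < n := by omega
  have hnR : (0 : ℝ) < n := by exact_mod_cast hn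
  have hε1 : 0 < 1 - ε := by linarith [hb.eps_lt]
  have hq := hk.q_pos
  set κ := (ε / (1 - ε)) ^ 2 with hκ
  have hκ0 : 0 ≤ κ := sq_nonneg _
  have hεκ : ε ^ 2 = (1 - ε) ^ 2 * κ := by rw [hκ, div_pow]; field_simp
  have hbε : b ≤ ε := by
    have := hb.eps_mul
    have : 0 ≤ ε * (k * b) :=
      mul_nonneg hb.eps_pos.le (mul_nonneg (Nat.cast_nonneg k) hb.b_pos.le)
    linarith
  have h := expect_pair_le (a := 0) (b := b) (θ := 1 - ε) (Δ := 1 / 2 ^ k) hkn hn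
    (fun y => (weight_pos hb y).le) hm (fun j => (j : ℝ) / n ≤ (1 - q) / 2)
    (fun x => κ * (2 ^ k * (1 - x) ^ k + 2 * k))
    (fun j hj hP => by
      have : 0 ≤ 1 - (j : ℝ) / n := by linarith
      positivity)
    (fun j hj hP => by
      have := Real.add_one_le_exp (κ * (2 ^ k * (1 - (j : ℝ) / n) ^ k + 2 * k))
      have := mul_le_mul_of_nonneg_left this (sq_nonneg (1 - ε))
      refine le_trans ?_ this
      have hT : 0 ≤ 2 ^ k * (1 - (j : ℝ) / n) ^ k := by
        have : 0 ≤ 1 - (j : ℝ) / n := by linarith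
        positivity
      generalize 2 ^ k * (1 - (j : ℝ) / n) ^ k = T at *
      -- Writing the bound in terms of `ε` puts both moments on the scale `(1 - ε) ^ 2`; the price
      -- is `2 * (ε - b) ≤ 2 * k * ε ^ 2`.
      have e1 : b ^ 2 * T ≤ ε ^ 2 * T := by
        have := hb.b_pos.le
        gcongr
      have e2 : ε - b ≤ k * ε ^ 2 := by
        have e3 := hb.eps_mul
        have e4 : k * ε * b ≤ k * ε * ε := by
          have := hb.eps_pos.le
          gcongr
        linarith
      have e5 : (1 - ε) ^ 2 * (κ * (T + 2 * k) + 1) = (1 - ε) ^ 2 + ε ^ 2 * (T + 2 * k) := by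
        rw [hεκ]; ring
      rw [e5]
      nlinarith [sq_nonneg ε])
    (fun j hj hP => by
      have := density_mul_overlap_le hk hb.ratio_le (x := (j : ℝ) / n) (by positivity) hP
      linarith)
  refine le_trans (le_of_eq ?_) (h.trans (le_of_eq ?_))
  · refine Finset.expect_congr rfl fun x _ => Finset.sum_congr rfl fun σ _ =>
      Finset.sum_congr rfl fun τ _ => ?_
    congr
  · rw [mul_pow, ← pow_mul, ← pow_mul, mul_comm n 2, pow_mul 2 2 n, mul_comm m 2]
    norm_num
    ring

/-- With at least inverse polynomial probability the partition function is almost as large as its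
balanced first moment. -/
theorem le_freq_partitionSum (hk : LargeLength k q) (hb : BalancedWeights k β b ε)
    (hkn : 2 * k ≤ n) {m : ℕ} (hm : (m : ℝ) ≤ (2 ^ k * Real.log 2 - 10 * k) * n) {C : ℝ}
    (hC : C = (n + 1) * Real.exp (2 * k ^ 2 * (2 ^ k * Real.log 2 - 10 * k))) :
    1 / (8 * C) ≤ freq fun x : Fin m → Clause k n =>
      2 ^ n * (1 - ε) ^ m / (32 * C) ≤ partitionSum b x := by
  have : Nonempty (Clause k n) := ⟨⟨Fin.castLEEmb (by omega), fun _ => 1⟩⟩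
  have hC0 : 0 < C := by rw [hC]; positivity
  have hε1 : 0 < 1 - ε := by linarith [hb.eps_lt]
  have hsecond := expect_balancedSum_sq_le hk hb hkn hm
  rw [← hC] at hsecond
  have hfirst : 𝔼 x : Fin m → Clause k n, balancedSum ε x = 2 ^ n * (1 - ε) ^ m :=
    expect_sum_prod_weight (by omega) ε ε m
  have hmul := expect_sum_prod_balanced_mul (ε := ε) (show k ≤ n by omega) m
  set L : ℝ := 2 ^ n * (1 - ε) ^ m with hL
  have hL0 : 0 < L := by positivity
  have hPZ := sq_expect_le_freq_mul_expect_sq (fun x : Fin m → Clause k n => balancedSum ε x)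
    (by rw [hfirst]; exact hL0.le)
  rw [hfirst] at hPZ
  set S : (Fin m → Clause k n) → ℝ := fun x => ∑ σ : Assignment n,
      ∏ i, (weight ε ε (literals (x i) σ) * weight ε 0 (literals (x i) σ)) with hS
  have hS0 : ∀ x, 0 ≤ S x := fun x => Finset.sum_nonneg fun σ _ => Finset.prod_nonneg fun i _ =>
    mul_nonneg (balanced_weight_nonneg hb _)
      (weight_right_zero_nonneg hb.eps_pos.le hb.eps_mul_le _)
  -- The level `8 * C * L` makes the Markov probability `1 / (8 * C)`, half of the Paley–Zygmund
  -- bound `1 / (4 * C)`.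
  have hMarkov := mul_freq_le_expect (fun x => 8 * C * L ≤ S x) S (8 * C * L) hS0 fun x h => h
  rw [hmul] at hMarkov
  have hp : 1 / (4 * C) ≤ freq fun x : Fin m → Clause k n => L / 2 ≤ balancedSum ε x := by
    rw [div_le_iff₀ (by positivity)]
    have h1 := hPZ.trans (mul_le_mul_of_nonneg_left hsecond
      (mul_nonneg (by norm_num) (freq_nonneg _)))
    have h2 : 0 < L ^ 2 := by positivity
    refine le_of_mul_le_mul_right ?_ h2
    linarith
  have hq' : (freq fun x => 8 * C * L ≤ S x) ≤ 1 / (8 * C) := by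
    rw [le_div_iff₀ (by positivity)]
    refine le_of_mul_le_mul_right ?_ hL0
    linarith
  have hcover : (freq fun x : Fin m → Clause k n => L / 2 ≤ balancedSum ε x)
      ≤ (freq fun x : Fin m → Clause k n => L / (32 * C) ≤ partitionSum b x)
        + freq fun x => 8 * C * L ≤ S x := by
    refine le_trans (freq_mono fun x hx => ?_) (freq_or_le _ _)
    by_cases hSx : 8 * C * L ≤ S x
    · exact Or.inr hSx
    · left
      push Not at hSx
      have h1 := balancedSum_sq_le hb x
      have h2 : (L / 2) ^ 2 ≤ balancedSum ε x ^ 2 := by gcongr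
      have h3 : partitionSum b x * S x ≤ partitionSum b x * (8 * C * L) :=
        mul_le_mul_of_nonneg_left hSx.le (partitionSum_pos hb x).le
      rw [div_le_iff₀ (by positivity)]
      refine le_of_mul_le_mul_right ?_ hL0
      have h4 := h2.trans (h1.trans h3)
      linarith
  have : 1 / (4 * C) = 1 / (8 * C) + 1 / (8 * C) := by field_simp; norm_num
  linarith

/-- The partition function is concentrated on the exponential scale. -/
theorem freq_log_partitionSum_le (hk : LargeLength k q) (hb : BalancedWeights k β b ε)
    (hkn : 2 * k ≤ n) {m : ℕ} {M : ℝ} (hM : M = 2 ^ k * Real.log 2 - 10 * k) (hM0 : 0 < M)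
    (hm : (m : ℝ) ≤ M * n) {C η : ℝ} (hη : 0 < η)
    (hC : C = (n + 1) * Real.exp (2 * k ^ 2 * M)) :
    (freq fun x : Fin m → Clause k n =>
      Real.log (partitionSum b x) ≤ Real.log (2 ^ n * (1 - ε) ^ m) - η * n)
      ≤ 8 * C * Real.exp (η / (M * β ^ 2) * Real.log (32 * C) - η ^ 2 / (2 * M * β ^ 2) * n) := by
  have : Nonempty (Clause k n) := ⟨⟨Fin.castLEEmb (by omega), fun _ => 1⟩⟩
  have hC0 : 0 < C := by rw [hC]; positivity
  have hε1 : 0 < 1 - ε := by linarith [hb.eps_lt]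
  have hβ := hb.beta_pos
  have hlow := le_freq_partitionSum hk hb hkn (hM ▸ hm) (hM ▸ hC)
  set L : ℝ := 2 ^ n * (1 - ε) ^ m with hL
  have hL0 : 0 < L := by positivity
  have hlow' : 1 / (8 * C) ≤ freq fun x : Fin m → Clause k n =>
      Real.log L - Real.log (32 * C) ≤ Real.log (partitionSum b x) := by
    refine hlow.trans (freq_mono fun x hx => ?_)
    rw [← Real.log_div hL0.ne' (by positivity)]
    exact Real.log_le_log (by positivity) hx
  -- The choice `l = η / (M * β ^ 2)` minimises `M * n * l ^ 2 * β ^ 2 / 2 - l * η * n`.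
  have hconc := freq_ge_mul_freq_le_of_bounded_differences β m
    (fun x : Fin m → Clause k n => Real.log (partitionSum b x))
    (abs_log_partitionSum_update_sub_le hb) (Real.log L - Real.log (32 * C))
    (η * n - Real.log (32 * C)) (η / (M * β ^ 2)) (by positivity)
  have e : Real.log L - Real.log (32 * C) - (η * n - Real.log (32 * C)) = Real.log L - η * n := by
    ring
  rw [e] at hconc
  have hexp : (m : ℝ) * ((η / (M * β ^ 2)) ^ 2 * β ^ 2 / 2) - η / (M * β ^ 2) *
      (η * n - Real.log (32 * C))
      ≤ η / (M * β ^ 2) * Real.log (32 * C) - η ^ 2 / (2 * M * β ^ 2) * n := by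
    have h1 := mul_le_mul_of_nonneg_right hm
      (by positivity : 0 ≤ (η / (M * β ^ 2)) ^ 2 * β ^ 2 / 2)
    have h2 : M * n * ((η / (M * β ^ 2)) ^ 2 * β ^ 2 / 2) - η / (M * β ^ 2) * (η * n)
        = - (η ^ 2 / (2 * M * β ^ 2) * n) := by field_simp; ring
    linarith
  have h3 := hconc.trans (Real.exp_le_exp.2 hexp)
  have h4 := (mul_le_mul_of_nonneg_right hlow' (freq_nonneg _)).trans h3
  rw [one_div, inv_mul_le_iff₀ (by positivity)] at h4
  exact h4

open Classical in
/-- The formulas under which two independent samples have a large overlap are rare. -/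
theorem freq_large_overlap_le (hk : LargeLength k q) (hb : BalancedWeights k β b ε)
    (hkn : 2 * k ≤ n) {m : ℕ} {M : ℝ} (hM : M = 2 ^ k * Real.log 2 - 10 * k) (hM0 : 0 < M)
    (hm : (m : ℝ) ≤ M * n) {C η : ℝ} (hη : 0 < η) (hC : C = (n + 1) * Real.exp (2 * k ^ 2 * M)) :
    (freq fun x : Fin m → Clause k n => q * partitionSum b x ^ 2 ≤
      ∑ σ : Assignment n, ∑ τ : Assignment n, (if (hammingDist σ τ : ℝ) / n ≤ (1 - q) / 2 then
        (∏ i, weight 0 b (literals (x i) σ)) * ∏ i, weight 0 b (literals (x i) τ) else 0))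
      ≤ 8 * C * Real.exp (η / (M * β ^ 2) * Real.log (32 * C) - η ^ 2 / (2 * M * β ^ 2) * n)
        + C / q * Real.exp (-(1 / 2 ^ k - 2 * η) * n) := by
  have hC0 : 0 < C := by rw [hC]; positivity
  have hε1 : 0 < 1 - ε := by linarith [hb.eps_lt]
  have hq := hk.q_pos
  have hconc := freq_log_partitionSum_le hk hb hkn hM hM0 hm hη hC
  have hW := expect_large_overlap_le hk hb hkn (hM ▸ hm)
  rw [← hM, ← hC] at hW
  set L : ℝ := 2 ^ n * (1 - ε) ^ m with hL
  have hL0 : 0 < L := by positivity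
  set W : (Fin m → Clause k n) → ℝ := fun x => ∑ σ : Assignment n, ∑ τ : Assignment n,
    (if (hammingDist σ τ : ℝ) / n ≤ (1 - q) / 2 then
      (∏ i, weight 0 b (literals (x i) σ)) * ∏ i, weight 0 b (literals (x i) τ) else 0) with hWdef
  have hW0 : ∀ x, 0 ≤ W x := fun x => Finset.sum_nonneg fun σ _ => Finset.sum_nonneg fun τ _ => by
    split_ifs
    · exact mul_nonneg (Finset.prod_nonneg fun _ _ => (weight_pos hb _).le)
        (Finset.prod_nonneg fun _ _ => (weight_pos hb _).le)
    · exact le_rfl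
  set t := q * (L * Real.exp (-(η * n))) ^ 2 with ht
  have ht0 : 0 < t := by positivity
  have hMarkov := (mul_freq_le_expect (fun x => t ≤ W x) W t hW0 fun x h => h).trans hW
  have hle : (freq fun x => t ≤ W x) ≤ C / q * Real.exp (-(1 / 2 ^ k - 2 * η) * n) := by
    refine le_of_mul_le_mul_left (hMarkov.trans (le_of_eq ?_)) ht0
    have : Real.exp (-(n * (1 / 2 ^ k)))
        = Real.exp (-(η * n)) ^ 2 * Real.exp (-(1 / 2 ^ k - 2 * η) * n) := by
      rw [← Real.exp_nat_mul, ← Real.exp_add]; congr 1; push_cast; ring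
    rw [this, ht]
    field_simp
  refine le_trans (freq_mono fun x hx => ?_) ((freq_or_le _ _).trans (add_le_add hconc hle))
  by_cases h : Real.log (partitionSum b x) ≤ Real.log L - η * n
  · exact Or.inl h
  · right
    push Not at h
    refine le_trans ?_ hx
    have h1 : L * Real.exp (-(η * n)) ≤ partitionSum b x := by
      rw [← Real.exp_log hL0, ← Real.exp_log (partitionSum_pos hb x), ← Real.exp_add]
      exact Real.exp_le_exp.2 (by linarith)
    rw [ht]
    gcongr

end SecondMoment

/-! ### From marginals to overlaps. -/

section Marginals

open Finset
open scoped BigOperators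

variable {k n : ℕ} {β b ε : ℝ}

theorem exp_violated (hb : BalancedWeights k β b ε) {m : ℕ} (x : Fin m → Clause k n)
    (σ : Assignment n) :
    Real.exp (-β * violated ⟨m, x⟩ σ) = ∏ i, weight 0 b (literals (x i) σ) := by
  classical
  rw [violated, Nat.cast_sum, Finset.mul_sum, Real.exp_sum]
  refine Finset.prod_congr rfl fun i _ => ?_
  by_cases h : Satisfies σ (x i)
  · rw [show weight 0 b (literals (x i) σ) = 1 from weight_zero_of_exists b h]
    simp [h]
  · rw [show weight 0 b (literals (x i) σ) = 1 - b * 2 ^ k from weight_zero_of_forall b h, hb.b_mul]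
    simp [h]

theorem partitionFunction_eq (hb : BalancedWeights k β b ε) {m : ℕ} (x : Fin m → Clause k n) :
    partitionFunction ⟨m, x⟩ β = partitionSum b x :=
  Finset.sum_congr rfl fun σ _ => exp_violated hb x σ

theorem partitionFunction_pos (Φ : Formula k n) (β : ℝ) : 0 < partitionFunction Φ β :=
  Finset.sum_pos (fun _ _ => Real.exp_pos _) univ_nonempty

theorem boltzmann_nonneg (Φ : Formula k n) (β : ℝ) (σ : Assignment n) : 0 ≤ boltzmann Φ β σ :=
  div_nonneg (Real.exp_pos _).le (partitionFunction_pos Φ β).le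

theorem sum_boltzmann (Φ : Formula k n) (β : ℝ) : ∑ σ, boltzmann Φ β σ = 1 := by
  simp_rw [boltzmann, ← Finset.sum_div]
  exact div_self (partitionFunction_pos Φ β).ne'

theorem two_mul_boltzmannProb_sub_one (Φ : Formula k n) (β : ℝ) (i : Fin n) :
    2 * boltzmannProb Φ β {σ | σ i = 1} - 1 = ∑ σ, ((σ i : ℤ) : ℝ) * boltzmann Φ β σ := by
  rw [← sum_boltzmann Φ β, boltzmannProb, Finset.mul_sum, ← Finset.sum_sub_distrib]
  refine Finset.sum_congr rfl fun σ _ => ?_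
  rcases Int.units_eq_one_or (σ i) with h | h
  · simp [Set.indicator, h]; ring
  · have : (-1 : ℤˣ) ≠ 1 := by decide
    simp [Set.indicator, h, this]

/-- The mean overlap of two independent samples in terms of the marginals. -/
theorem sum_sq_marginals (Φ : Formula k n) (β : ℝ) :
    ∑ i, (2 * boltzmannProb Φ β {σ | σ i = 1} - 1) ^ 2
      = ∑ σ, ∑ τ, (n - 2 * hammingDist σ τ) * (boltzmann Φ β σ * boltzmann Φ β τ) := by
  simp_rw [two_mul_boltzmannProb_sub_one, sq, Finset.sum_mul_sum]
  rw [Finset.sum_comm]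
  refine Finset.sum_congr rfl fun σ _ => ?_
  rw [Finset.sum_comm]
  refine Finset.sum_congr rfl fun τ _ => ?_
  rw [← sum_mul_eq_sub_hammingDist, Finset.sum_mul]
  refine Finset.sum_congr rfl fun i _ => ?_
  push_cast
  ring

open Classical in
theorem sum_sq_marginals_le (hn : 0 < n) (Φ : Formula k n) (β : ℝ) {q : ℝ} (hq : 0 ≤ q) :
    ∑ i, (2 * boltzmannProb Φ β {σ | σ i = 1} - 1) ^ 2
      ≤ n * (q + ∑ σ : Assignment n, ∑ τ : Assignment n,
        if (hammingDist σ τ : ℝ) / n ≤ (1 - q) / 2 then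
          boltzmann Φ β σ * boltzmann Φ β τ else 0) := by
  have hnR : (0 : ℝ) < n := by exact_mod_cast hn
  have h1 : ∑ σ : Assignment n, ∑ τ : Assignment n, q * (boltzmann Φ β σ * boltzmann Φ β τ)
      = q := by
    simp_rw [← Finset.mul_sum, sum_boltzmann, mul_one]
    rw [sum_boltzmann, mul_one]
  rw [sum_sq_marginals]
  conv_rhs => enter [2, 1]; rw [← h1]
  simp_rw [← Finset.sum_add_distrib, Finset.mul_sum]
  refine Finset.sum_le_sum fun σ _ => Finset.sum_le_sum fun τ _ => ?_
  have hB := mul_nonneg (boltzmann_nonneg Φ β σ) (boltzmann_nonneg Φ β τ)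
  generalize boltzmann Φ β σ * boltzmann Φ β τ = B at *
  have hd : (0 : ℝ) ≤ hammingDist σ τ := Nat.cast_nonneg _
  split_ifs with h
  · have : (n - 2 * (hammingDist σ τ : ℝ)) * B ≤ n * B := by gcongr; linarith
    have : 0 ≤ n * (q * B) := by positivity
    linarith
  · push Not at h
    rw [lt_div_iff₀ hnR] at h
    have h2 : (n - 2 * (hammingDist σ τ : ℝ)) * B ≤ n * q * B := by gcongr; linarith
    linarith

/-- The overlap that very slim tails exclude. -/
def overlapBound (k : ℕ) : ℝ := 2 * (2 : ℝ) ^ (-(14 * (k : ℝ) / 45))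

theorem overlapBound_eq (k : ℕ) : 2 * overlapBound k
    = (2 * (2 : ℝ) ^ (-(k : ℝ) / 10)) ^ 2 * (2 : ℝ) ^ (-(k : ℝ) / 9) := by
  have e : ((2 : ℝ) ^ (-(k : ℝ) / 10)) ^ 2 * (2 : ℝ) ^ (-(k : ℝ) / 9)
      = (2 : ℝ) ^ (-(14 * (k : ℝ) / 45)) := by
    rw [sq, ← Real.rpow_add two_pos, ← Real.rpow_add two_pos]
    congr 1; ring
  rw [overlapBound, mul_pow, mul_assoc, e]
  ring

/-- A Chebyshev count: each marginal in the tails contributes at least `(2 * δ) ^ 2` with `δ = 2 ^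
(-k / 10)`. The exponent `14 / 45 = 2 / 10 + 1 / 9` in `overlapBound` is chosen for this. -/
theorem verySlimTails_of_sum_le (hn : 0 < n) (Φ : Formula k n) (β : ℝ)
    (h : ∑ i, (2 * boltzmannProb Φ β {σ | σ i = 1} - 1) ^ 2 ≤ n * (2 * overlapBound k)) :
    VerySlimTails k (empiricalMarginals Φ β) := by
  classical
  have hnR : (0 : ℝ) < n := by exact_mod_cast hn
  set δ : ℝ := (2 : ℝ) ^ (-(k : ℝ) / 10) with hδ
  have hδ0 : 0 < δ := by positivity
  set S : Set ℝ := Set.Icc 0 (1 / 2 - δ) ∪ Set.Icc (1 / 2 + δ) 1 with hS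
  have hSm : MeasurableSet S := measurableSet_Icc.union measurableSet_Icc
  set p : Fin n → ℝ := fun i => boltzmannProb Φ β {σ | σ i = 1} with hp
  have hcount : (#{i | p i ∈ S} : ℝ) * (2 * δ) ^ 2 ≤ n * (2 * overlapBound k) := by
    refine le_trans ?_ h
    rw [← nsmul_eq_mul, ← Finset.sum_const]
    refine le_trans (Finset.sum_le_sum (g := fun i => (2 * p i - 1) ^ 2) fun i hi => ?_)
      (Finset.sum_le_sum_of_subset_of_nonneg (Finset.subset_univ _) fun i _ _ => sq_nonneg _)
    rcases (Finset.mem_filter.1 hi).2 with hi | hi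
    · have := hi.2; nlinarith
    · have := hi.1; nlinarith
  rw [overlapBound_eq, ← hδ] at hcount
  have hcard : (#{i | p i ∈ S} : ℝ) ≤ n * (2 : ℝ) ^ (-(k : ℝ) / 9) := by
    have h2 : 0 < (2 * δ) ^ 2 := by positivity
    refine le_of_mul_le_mul_right ?_ h2
    linarith
  have hval : empiricalMarginals Φ β S = (n : ENNReal)⁻¹ * (#{i | p i ∈ S} : ENNReal) := by
    rw [empiricalMarginals, Measure.smul_apply, Measure.finsetSum_apply, smul_eq_mul]
    congr 1
    simp_rw [Measure.dirac_apply' _ hSm]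
    rw [Finset.card_filter, Nat.cast_sum]
    refine Finset.sum_congr rfl fun i _ => ?_
    by_cases hi : p i ∈ S
    · rw [Set.indicator_of_mem hi]; simp [hi]
    · rw [Set.indicator_of_notMem hi]; simp [hi]
  rw [VerySlimTails, hval]
  rw [ENNReal.inv_mul_le_iff (by exact_mod_cast hn.ne') (ENNReal.natCast_ne_top n),
    ← ENNReal.ofReal_natCast n, ← ENNReal.ofReal_natCast, ← ENNReal.ofReal_mul hnR.le]
  exact ENNReal.ofReal_le_ofReal hcard

open Classical in
/-- If the tails are not very slim, then two independent samples have a large overlap. -/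
theorem le_large_overlap_of_not_verySlimTails (hb : BalancedWeights k β b ε) (hn : 0 < n) {m : ℕ}
    (x : Fin m → Clause k n)
    (h : ¬VerySlimTails k (empiricalMarginals (⟨m, x⟩ : Formula k n) β)) :
    overlapBound k * partitionSum b x ^ 2 ≤
      ∑ σ : Assignment n, ∑ τ : Assignment n,
        (if (hammingDist σ τ : ℝ) / n ≤ (1 - overlapBound k) / 2 then
          (∏ i, weight 0 b (literals (x i) σ)) * ∏ i, weight 0 b (literals (x i) τ) else 0) := by
  have hnR : (0 : ℝ) < n := by exact_mod_cast hn
  have hq : 0 ≤ overlapBound k := by unfold overlapBound; positivity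
  have h1 : n * (2 * overlapBound k)
      < ∑ i, (2 * boltzmannProb (⟨m, x⟩ : Formula k n) β {σ | σ i = 1} - 1) ^ 2 := by
    by_contra hcon
    exact h (verySlimTails_of_sum_le hn _ β (not_lt.1 hcon))
  have h2 := h1.trans_le (sum_sq_marginals_le hn _ β hq)
  have h3 := (lt_of_mul_lt_mul_left h2 hnR.le).le
  have hZ := partitionSum_pos hb x
  have h4 : ∑ σ : Assignment n, ∑ τ : Assignment n,
        (if (hammingDist σ τ : ℝ) / n ≤ (1 - overlapBound k) / 2 then
          boltzmann (⟨m, x⟩ : Formula k n) β σ * boltzmann (⟨m, x⟩ : Formula k n) β τ else 0)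
      = (∑ σ : Assignment n, ∑ τ : Assignment n,
        (if (hammingDist σ τ : ℝ) / n ≤ (1 - overlapBound k) / 2 then
          (∏ i, weight 0 b (literals (x i) σ)) * ∏ i, weight 0 b (literals (x i) τ) else 0))
        / partitionSum b x ^ 2 := by
    simp_rw [Finset.sum_div]
    refine Finset.sum_congr rfl fun σ _ => Finset.sum_congr rfl fun τ _ => ?_
    split_ifs
    · rw [boltzmann, boltzmann, partitionFunction_eq hb, exp_violated hb, exp_violated hb]
      field_simp
    · simp
  rw [h4] at h3
  rw [← le_div_iff₀ (by positivity)]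
  linarith

end Marginals

/-! ### The random formula conditioned on its length, and Poisson tails. -/

section Law

open Finset

variable {k n : ℕ}

theorem uniformOn_length_eq (m : ℕ) (A : Set (Formula k n)) (hkn : k ≤ n) :
    ProbabilityTheory.uniformOn {Φ : Formula k n | Φ.m = m} A
      = ENNReal.ofReal (freq fun x : Fin m → Clause k n => (⟨m, x⟩ : Formula k n) ∈ A) := by
  classical
  have : Nonempty (Clause k n) := ⟨⟨Fin.castLEEmb hkn, fun _ => 1⟩⟩
  have : MeasurableSingletonClass (Formula k n) := ⟨fun _ => trivial⟩
  set e : (Fin m → Clause k n) ↪ Formula k n :=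
    ⟨fun x => ⟨m, x⟩, fun x y h => by simpa using h⟩ with he
  have hset : {Φ : Formula k n | Φ.m = m} = ((univ.map e : Finset (Formula k n)) : Set _) := by
    ext Φ
    simp only [Set.mem_ofPred_eq, Finset.coe_map, Finset.coe_univ, Set.image_univ, Set.mem_range]
    constructor
    · rintro rfl
      exact ⟨Φ.clause, rfl⟩
    · rintro ⟨x, rfl⟩
      rfl
  set t : Finset (Formula k n) := (univ.filter fun x => e x ∈ A).map e with ht
  have hinter : ((univ.map e : Finset (Formula k n)) : Set _) ∩ A = (t : Set (Formula k n)) := by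
    ext Φ
    simp only [ht, Finset.coe_map, Finset.coe_univ, Set.image_univ, Set.mem_inter_iff,
      Set.mem_range, Finset.coe_filter, Finset.mem_univ, true_and, Set.mem_image, Set.mem_ofPred_eq]
    constructor
    · rintro ⟨⟨x, rfl⟩, hA⟩
      exact ⟨x, hA, rfl⟩
    · rintro ⟨x, hA, rfl⟩
      exact ⟨⟨x, rfl⟩, hA⟩
  have htsub : univ.map e ∩ t = t := by
    rw [Finset.inter_eq_right, ht]
    exact Finset.map_subset_map.2 (Finset.subset_univ _)
  rw [hset, ← ProbabilityTheory.uniformOn_inter_self (Finset.finite_toSet _), hinter,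
    ProbabilityTheory.uniformOn_apply_finset, htsub, ht, Finset.card_map, Finset.card_map, freq,
    Fintype.expect_eq_sum_div_card, Finset.sum_boole, Finset.card_univ,
    ENNReal.ofReal_div_of_pos (by exact_mod_cast Fintype.card_pos), ENNReal.ofReal_natCast,
    ENNReal.ofReal_natCast]
  rfl

theorem randomFormula_apply (d : ℝ) (A : Set (Formula k n)) :
    randomFormula k n d A = ∫⁻ m, ProbabilityTheory.uniformOn {Φ : Formula k n | Φ.m = m} A
      ∂ProbabilityTheory.poissonMeasure (d * n / k).toNNReal :=
  Measure.bind_apply trivial (Measurable.of_discrete).aemeasurable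

theorem isProbabilityMeasure_randomFormula (hkn : k ≤ n) (d : ℝ) :
    IsProbabilityMeasure (randomFormula k n d) := by
  have : Nonempty (Clause k n) := ⟨⟨Fin.castLEEmb hkn, fun _ => 1⟩⟩
  refine ⟨?_⟩
  rw [randomFormula_apply]
  have : ∀ m, ProbabilityTheory.uniformOn {Φ : Formula k n | Φ.m = m} Set.univ = 1 := fun m => by
    rw [uniformOn_length_eq m _ hkn]
    simp [freq]
  simp_rw [this]
  simp

theorem randomFormula_le (hkn : k ≤ n) (d M δ : ℝ) (A : Set (Formula k n))
    (hA : ∀ m : ℕ, (m : ℝ) ≤ M * n →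
      (freq fun x : Fin m → Clause k n => (⟨m, x⟩ : Formula k n) ∈ A) ≤ δ) :
    randomFormula k n d A ≤ ENNReal.ofReal δ
      + ProbabilityTheory.poissonMeasure (d * n / k).toNNReal {m : ℕ | M * n ≤ m} := by
  have : Nonempty (Clause k n) := ⟨⟨Fin.castLEEmb hkn, fun _ => 1⟩⟩
  have hle : ∀ m : ℕ, ProbabilityTheory.uniformOn {Φ : Formula k n | Φ.m = m} A
      ≤ ENNReal.ofReal δ + Set.indicator {m : ℕ | M * n ≤ m} 1 m := by
    intro m
    rw [uniformOn_length_eq m A hkn]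
    by_cases hm : (m : ℝ) ≤ M * n
    · exact le_add_right (ENNReal.ofReal_le_ofReal (hA m hm))
    · rw [Set.indicator_of_mem (show m ∈ {m : ℕ | M * n ≤ m} from (not_le.1 hm).le)]
      refine le_add_left ?_
      rw [Pi.one_apply, ← ENNReal.ofReal_one]
      refine ENNReal.ofReal_le_ofReal ?_
      refine (freq_mono (B := fun _ => True) fun _ _ => trivial).trans ?_
      simp [freq]
  rw [randomFormula_apply]
  refine (lintegral_mono hle).trans ?_
  rw [lintegral_add_left measurable_const, lintegral_const, measure_univ, mul_one,
    lintegral_indicator_one .of_discrete]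

/-- Tilting by `exp (t * m)` turns the Poisson law of mean `r` into a multiple of that of mean `r *
exp t`. -/
theorem hasSum_poisson_mul_exp (r : NNReal) (t : ℝ) :
    HasSum (fun m : ℕ => Real.exp (-r) * r ^ m / m.factorial * Real.exp (t * m))
      (Real.exp (r * (Real.exp t - 1))) := by
  obtain ⟨s, hs⟩ : ∃ s : NNReal, (s : ℝ) = r * Real.exp t :=
    ⟨r * ⟨Real.exp t, (Real.exp_pos t).le⟩, rfl⟩
  have h := (ProbabilityTheory.hasSum_one_poissonMeasure s).mul_left
    (Real.exp (r * (Real.exp t - 1)))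
  rw [mul_one] at h
  refine h.congr_fun fun m => ?_
  have e1 : Real.exp (-r) = Real.exp (r * (Real.exp t - 1)) * Real.exp (-(r * Real.exp t)) := by
    rw [← Real.exp_add]; ring_nf
  rw [hs, e1, mul_pow, mul_comm t, Real.exp_nat_mul]
  ring

theorem poissonMeasure_ge_le (r : NNReal) (s : ℝ) {t : ℝ} (ht : 0 ≤ t) :
    ProbabilityTheory.poissonMeasure r {m : ℕ | s ≤ m}
      ≤ ENNReal.ofReal (Real.exp (r * (Real.exp t - 1) - t * s)) := by
  have hint : Integrable (fun m : ℕ => Real.exp (t * m)) (ProbabilityTheory.poissonMeasure r) := by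
    rw [ProbabilityTheory.integrable_poissonMeasure_iff]
    refine (hasSum_poisson_mul_exp r t).summable.congr fun m => ?_
    rw [Real.norm_eq_abs, Real.abs_exp]
  have h := ProbabilityTheory.measure_ge_le_exp_mul_mgf (X := fun m : ℕ => (m : ℝ)) s ht hint
  have hmgf : ProbabilityTheory.mgf (fun m : ℕ => (m : ℝ)) (ProbabilityTheory.poissonMeasure r) t
      = Real.exp (r * (Real.exp t - 1)) := by
    rw [ProbabilityTheory.mgf, ProbabilityTheory.integral_poissonMeasure]
    exact (hasSum_poisson_mul_exp r t).tsum_eq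
  rw [hmgf, ← Real.exp_add] at h
  rw [← ENNReal.ofReal_toReal (measure_ne_top (ProbabilityTheory.poissonMeasure r) _)]
  refine ENNReal.ofReal_le_ofReal (h.trans (le_of_eq ?_))
  congr 1; ring

end Law

/-! ### Large `k`, and vanishing error terms as `n` grows. -/

section Limits

theorem eventually_largeLength : ∀ᶠ k : ℕ in atTop, LargeLength k (overlapBound k) := by
  have hcast := tendsto_natCast_atTop_atTop (R := ℝ)
  have hlog2 := Real.log_two_gt_d9
  have h1 : ∀ᶠ k : ℕ in atTop, 2 + 2 * Real.log k ≤ Real.log 2 * k / 21 := by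
    have hl := (Real.isLittleO_log_id_atTop.comp_tendsto hcast).bound
      (show (0 : ℝ) < 1 / 200 by norm_num)
    filter_upwards [hl, eventually_ge_atTop 200] with k hk hk2
    have hkR : (200 : ℝ) ≤ k := by exact_mod_cast hk2
    simp only [Function.comp_apply, id_eq, Real.norm_eq_abs] at hk
    rw [abs_of_nonneg (Nat.cast_nonneg k : (0 : ℝ) ≤ k)] at hk
    have := (le_abs_self _).trans hk
    nlinarith
  have h2 : ∀ᶠ k : ℕ in atTop, (2 * k + 1) * (k : ℝ) ^ 2 ≤ 2 ^ k := by
    have := (tendsto_pow_const_div_const_pow_of_one_lt 3 (one_lt_two (α := ℝ))).eventually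
      (gt_mem_nhds (show (0 : ℝ) < 1 / 3 by norm_num))
    filter_upwards [this, eventually_ge_atTop 1] with k hk hk1
    have hkR : (1 : ℝ) ≤ k := by exact_mod_cast hk1
    rw [div_lt_iff₀ (by positivity)] at hk
    nlinarith [sq_nonneg (k : ℝ)]
  have hdecay : ∀ c : ℝ, 0 < c → ∀ s : ℝ, Tendsto (fun k : ℕ => (k : ℝ) ^ s * (2 : ℝ) ^ (-(c * k)))
      atTop (𝓝 0) := by
    intro c hc s
    have := (tendsto_rpow_mul_exp_neg_mul_atTop_nhds_zero s (Real.log 2 * c)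
      (by positivity)).comp hcast
    refine this.congr fun k => ?_
    simp only [Function.comp_apply]
    rw [Real.rpow_def_of_pos two_pos]
    ring_nf
  have h3 : ∀ᶠ k : ℕ in atTop, overlapBound k ≤ 1 / k := by
    have := (hdecay (14 / 45) (by norm_num) 1).eventually
      (gt_mem_nhds (show (0 : ℝ) < 1 / 2 by norm_num))
    filter_upwards [this, eventually_ge_atTop 1] with k hk hk1
    have hkR : (1 : ℝ) ≤ k := by exact_mod_cast hk1
    rw [Real.rpow_one] at hk
    rw [le_div_iff₀ (by linarith), overlapBound]
    have e : -(14 * (k : ℝ) / 45) = -(14 / 45 * k) := by ring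
    rw [e]
    linarith
  have h4 : ∀ᶠ k : ℕ in atTop, (2 * k + 4) / (2 : ℝ) ^ k ≤ overlapBound k ^ 2 / 2 := by
    -- The square of `overlapBound` decays like `2 ^ (-28 * k / 45)`, leaving room `17 / 45 = 1 - 28
    -- / 45` over `2 ^ (-k)`.
    have := (hdecay (17 / 45) (by norm_num) 1).eventually
      (gt_mem_nhds (show (0 : ℝ) < 1 / 6 by norm_num))
    filter_upwards [this, eventually_ge_atTop 1] with k hk hk1
    have hkR : (1 : ℝ) ≤ k := by exact_mod_cast hk1
    rw [Real.rpow_one] at hk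
    rw [div_le_iff₀ (by positivity), overlapBound, mul_pow, ← Real.rpow_natCast,
      ← Real.rpow_natCast _ 2, ← Real.rpow_natCast _ k, ← Real.rpow_mul two_pos.le]
    have e : (2 : ℝ) ^ ((2 : ℕ) : ℝ) * (2 : ℝ) ^ (-(14 * (k : ℝ) / 45) * (2 : ℕ)) / 2 * 2 ^ (k : ℝ)
        = 2 * ((2 : ℝ) ^ (-(17 / 45 * (k : ℝ))))⁻¹ := by
      rw [← Real.rpow_neg two_pos.le, neg_neg]
      have : (2 : ℝ) ^ (17 / 45 * (k : ℝ))
          = (2 : ℝ) ^ (-(14 * (k : ℝ) / 45) * (2 : ℕ)) * 2 ^ (k : ℝ) := by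
        rw [← Real.rpow_add two_pos]; congr 1; push_cast; ring
      rw [this, Real.rpow_natCast]; ring
    rw [e, ← div_eq_mul_inv, le_div_iff₀ (by positivity)]
    have : 0 < (2 : ℝ) ^ (-(17 / 45 * (k : ℝ))) := by positivity
    nlinarith
  have h5 : ∀ᶠ k : ℕ in atTop,
      (3 / 4 : ℝ) ^ k + (2 * k + 1) / 2 ^ k ≤ 1 / (2 * (k : ℝ) ^ 2) := by
    have t1 := (tendsto_pow_const_div_const_pow_of_one_lt 2
      (show (1 : ℝ) < 4 / 3 by norm_num)).eventually
      (gt_mem_nhds (show (0 : ℝ) < 1 / 4 by norm_num))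
    have t2 := (tendsto_pow_const_div_const_pow_of_one_lt 3 (one_lt_two (α := ℝ))).eventually
      (gt_mem_nhds (show (0 : ℝ) < 1 / 12 by norm_num))
    filter_upwards [t1, t2, eventually_ge_atTop 1] with k hk1 hk2 hk
    have hkR : (1 : ℝ) ≤ k := by exact_mod_cast hk
    have e1 : (3 / 4 : ℝ) ^ k ≤ 1 / (4 * (k : ℝ) ^ 2) := by
      have : (3 / 4 : ℝ) ^ k = ((4 / 3 : ℝ) ^ k)⁻¹ := by rw [← inv_pow]; norm_num
      rw [this, le_div_iff₀ (by positivity), inv_mul_le_iff₀ (by positivity)]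
      rw [div_lt_iff₀ (by positivity)] at hk1
      linarith
    have e2 : (2 * k + 1) / (2 : ℝ) ^ k ≤ 1 / (4 * (k : ℝ) ^ 2) := by
      rw [div_le_div_iff₀ (by positivity) (by positivity)]
      rw [div_lt_iff₀ (by positivity)] at hk2
      nlinarith [sq_nonneg (k : ℝ)]
    have e3 : 1 / (2 * (k : ℝ) ^ 2) = 1 / (4 * (k : ℝ) ^ 2) + 1 / (4 * (k : ℝ) ^ 2) := by
      field_simp; norm_num
    linarith
  filter_upwards [eventually_ge_atTop 200, h1, h2, h3, h4, h5] with k k0 k1 k2 k3 k4 k5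
  exact ⟨k0, k1, k2, by unfold overlapBound; positivity, k3, k4, k5⟩

theorem tendsto_rpow_succ_mul_exp_neg (s : ℝ) {c : ℝ} (hc : 0 < c) :
    Tendsto (fun n : ℕ => ((n : ℝ) + 1) ^ s * Real.exp (-c * n)) atTop (𝓝 0) := by
  have h := (tendsto_rpow_mul_exp_neg_mul_atTop_nhds_zero s c hc).comp
    ((tendsto_natCast_atTop_atTop (R := ℝ)).atTop_add (tendsto_const_nhds (x := (1 : ℝ))))
  have h2 := h.mul_const (Real.exp c)
  rw [zero_mul] at h2
  refine h2.congr fun n => ?_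
  simp only [Function.comp_apply]
  rw [mul_assoc, ← Real.exp_add]
  ring_nf

theorem tendsto_overlap_error (q K l c c' : ℝ) (hK : 0 < K) (hc : 0 < c) (hc' : 0 < c') :
    Tendsto (fun n : ℕ => 8 * ((n + 1) * K) * Real.exp (l * Real.log (32 * ((n + 1) * K)) - c * n)
      + (n + 1) * K / q * Real.exp (-c' * n)) atTop (𝓝 0) := by
  have h1 := (tendsto_rpow_succ_mul_exp_neg (1 + l) hc).const_mul
    (8 * K * Real.exp (l * Real.log (32 * K)))
  have h2 := (tendsto_rpow_succ_mul_exp_neg 1 hc').const_mul (K / q)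
  have h3 := h1.add h2
  rw [mul_zero, mul_zero, add_zero] at h3
  refine h3.congr fun n => ?_
  have hn : (0 : ℝ) < n + 1 := by positivity
  have e : 32 * (((n : ℝ) + 1) * K) = 32 * K * (n + 1) := by ring
  rw [e, Real.log_mul (by positivity) hn.ne', Real.rpow_add hn, Real.rpow_one,
    Real.rpow_def_of_pos hn]
  have e2 : l * (Real.log (32 * K) + Real.log (n + 1)) - c * n
      = l * Real.log (32 * K) + Real.log (n + 1) * l + -c * n := by ring
  rw [e2, Real.exp_add, Real.exp_add]
  ring

theorem tendsto_poissonMeasure_ge {a M : ℝ} (ha : 0 < a) (haM : a < M) :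
    Tendsto (fun n : ℕ => ProbabilityTheory.poissonMeasure (a * n).toNNReal
      {m : ℕ | M * n ≤ m}) atTop (𝓝 0) := by
  -- For `t ≤ 1` one has `exp t - 1 ≤ t + t ^ 2`; the second bound on `t` keeps `a * t ^ 2` below
  -- half of `t * (M - a)`.
  set t := min 1 ((M - a) / (2 * a)) with ht
  have hpos : 0 < (M - a) / (2 * a) := div_pos (by linarith) (by linarith)
  have ht0 : 0 < t := lt_min one_pos hpos
  have ht1 : t ≤ 1 := min_le_left _ _
  have ht2 : t * (2 * a) ≤ M - a := by
    rw [← le_div_iff₀ (by linarith)]; exact min_le_right _ _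
  have hexp : Real.exp t - 1 - t ≤ t ^ 2 :=
    (le_abs_self _).trans (Real.abs_exp_sub_one_sub_id_le (by rwa [abs_of_pos ht0]))
  set c := t * M - a * (Real.exp t - 1) with hc
  have hc0 : 0 < c := by
    have h1 : a * (Real.exp t - 1) ≤ a * (t + t ^ 2) := mul_le_mul_of_nonneg_left (by linarith) ha.le
    have h2 := mul_le_mul_of_nonneg_left ht2 ht0.le
    have h3 : 0 < t ^ 2 * a := by positivity
    have h4 : 0 < t * (M - a) := mul_pos ht0 (by linarith)
    nlinarith
  have hlim : Tendsto (fun n : ℕ => ENNReal.ofReal (Real.exp (-c * n))) atTop (𝓝 0) := by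
    have := ENNReal.tendsto_ofReal (tendsto_rpow_succ_mul_exp_neg 0 hc0)
    simpa using this
  refine tendsto_of_tendsto_of_tendsto_of_le_of_le tendsto_const_nhds hlim (fun _ => zero_le)
    fun n => ?_
  refine (poissonMeasure_ge_le _ _ ht0.le).trans (ENNReal.ofReal_le_ofReal (Real.exp_le_exp.2 ?_))
  rw [Real.coe_toNNReal _ (by positivity)]
  rw [hc]
  ring_nf
  rfl

end Limits

/-- For every positive inverse temperature, the marginals of the random `k`-SAT model below
`dStar k` have very slim tails asymptotically almost surely. -/
theorem tendsto_randomFormula_verySlimTails :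
    ∃ k₀ : ℕ, 3 ≤ k₀ ∧
      ∀ (k : ℕ) (β d : ℝ), k₀ ≤ k → 0 < β → 0 < d → d < dStar k →
        Tendsto
          (fun n : ℕ => randomFormula k n d
            {Φ : Formula k n | VerySlimTails k (empiricalMarginals Φ β)})
          atTop (𝓝 1) := by
  obtain ⟨k₁, hk₁⟩ := eventually_atTop.1 eventually_largeLength
  refine ⟨max 3 k₁, le_max_left _ _, fun k β d hk hβ hd hdM => ?_⟩
  have hL := hk₁ k ((le_max_right _ _).trans hk)
  obtain ⟨b, ε, hb⟩ := exists_balancedWeights hL hβ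
  have hk0 : (0 : ℝ) < k := by
    have := hL.two_hundred_le
    exact_mod_cast (by omega : 0 < k)
  obtain ⟨M, hM⟩ : ∃ M : ℝ, M = 2 ^ k * Real.log 2 - 10 * k := ⟨_, rfl⟩
  have hdM' : d / k < M := by
    rw [div_lt_iff₀ hk0, hM]
    rw [dStar] at hdM
    linarith
  have hM0 : 0 < M := (div_pos hd hk0).trans hdM'
  -- The loss `2 * η` from `Z ^ 2` must stay below the gain `1 / 2 ^ k` of the overlap estimate;
  -- this `η` uses half of it.
  have hη : (0 : ℝ) < 1 / 2 ^ k / 4 := by positivity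
  set bad : (n : ℕ) → Set (Formula k n) := fun n =>
    {Φ | ¬VerySlimTails k (empiricalMarginals Φ β)} with hbad
  have hbound : ∀ n : ℕ, 2 * k ≤ n → randomFormula k n d (bad n) ≤ _ := fun n hn =>
    randomFormula_le (by omega) d M _ (bad n) fun m hm =>
      (freq_mono fun x hx => le_large_overlap_of_not_verySlimTails hb
        (by have := hL.two_hundred_le; omega) x hx).trans
      (freq_large_overlap_le hL hb hn hM hM0 hm hη rfl)
  have herr := (ENNReal.tendsto_ofReal (tendsto_overlap_error (overlapBound k)
    (Real.exp (2 * k ^ 2 * M)) (1 / 2 ^ k / 4 / (M * β ^ 2))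
    ((1 / 2 ^ k / 4) ^ 2 / (2 * M * β ^ 2)) (1 / 2 ^ k - 2 * (1 / 2 ^ k / 4)) (Real.exp_pos _)
    (by positivity) (by linarith))).add (tendsto_poissonMeasure_ge (div_pos hd hk0) hdM')
  rw [ENNReal.ofReal_zero, add_zero] at herr
  have hlim : Tendsto (fun n : ℕ => randomFormula k n d (bad n)) atTop (𝓝 0) := by
    refine tendsto_of_tendsto_of_tendsto_of_le_of_le' tendsto_const_nhds herr
      (Eventually.of_forall fun _ => zero_le) ?_
    filter_upwards [eventually_ge_atTop (2 * k)] with n hn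
    refine (hbound n hn).trans (le_of_eq ?_)
    rw [div_mul_eq_mul_div d]
  have hone := ENNReal.Tendsto.sub (tendsto_const_nhds (x := (1 : ENNReal))) hlim
    (Or.inl ENNReal.one_ne_top)
  rw [tsub_zero] at hone
  refine hone.congr' ?_
  filter_upwards [eventually_ge_atTop k] with n hn
  have := isProbabilityMeasure_randomFormula hn d
  rw [← prob_compl_eq_one_sub (MeasurableSpace.measurableSet_top)]
  congr 1
  ext Φ
  simp [hbad]

end RandomKSat

end

theorem corollary2p2 :
    ∃ k₀ : ℕ, 3 ≤ k₀ ∧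
      ∀ (k : ℕ) (β d : ℝ), k₀ ≤ k → 1 ≤ β → 0 < d → d < RandomKSat.dStar k →
        RandomKSat.ReplicaSymmetric k d β →
        Tendsto
          (fun n : ℕ => RandomKSat.randomFormula k n d
            {Φ : RandomKSat.Formula k n |
              RandomKSat.VerySlimTails k (RandomKSat.empiricalMarginals Φ β)})
          atTop (𝓝 1) := by
  obtain ⟨k₀, hk₀, h⟩ := RandomKSat.tendsto_randomFormula_verySlimTails
  exact ⟨k₀, hk₀, fun k β d hk hβ hd hdM _ => h k β d hk (by linarith) hd hdM⟩
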